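/- **Computations.** A *computation DAG* is a finite directed acyclic graph with continuation, future and touch edges, with a root of in-degree $0$ and a final node of out-degree $0$. A *thread* is a maximal chain of continuation edges; the main thread runs from the root to the final node and is not touched. Every other thread (a *future thread*) starts at a node whose only incoming edge is a future edge, and the only edge leaving its last node is a touch edge. A *fork* $v$ has exactly two outgoing edges: a future edge to its left child, the first node of the future thread spawned at $v$, and a continuation edge to its right child, which has in-degree $1$. Any other node has at most one outgoing touch edge. A *touch* is a node $x$ with exactly two incoming edges: a continuation edge from its *local parent* and a touch edge from a node of another, future, thread $t$; then $x$ is called a touch of $t$. The root and final node aside, every node thus has in-degree and out-degree $1$ or $2$. The computation is *structured single-touch* if, for every fork $v$ with future thread $t$, there is exactly one touch of $t$, its local parent is a descendant of $v$, and it is a descendant of the right child of $v$. The span $T_\infty$ is the length (number of edges) of a longest directed path. **Work stealing, future thread first.** Each of $P\ge 1$ processors has a deque. At the start one processor is about to execute the root, the others have nothing to execute, and all deques are empty. At every time step one processor acts. If it has a node to execute, it executes it and goes on with a child all of whose parents have been executed, if there is one; at a fork it goes on with the left child and pushes the right child onto the bottom of its deque. If it has no node to execute and its deque is nonempty, it pops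 the bottom node and has it to execute. If its deque is empty too, it makes a *steal attempt*: it picks a victim uniformly at random among the $P$ processors, independently of everything before, and takes the top node of the victim's deque, if there is one. Which processor acts is decided by an arbitrary adaptive adversary who knows the past but not the future random choices. The adversary is *$\kappa$-fair*: in every time interval in which some processor makes more than $\kappa$ steal attempts, every processor acts at least once. (For instance, round-robin is $1$-fair. Processors may fall asleep while others execute nodes.) **Costs.** The sequential execution is the execution with $P=1$. A node $b$ is a *deviation* of a parallel execution if $b$ has an immediate predecessor $a$ in the sequential execution, but the processor that executes $b$ in the parallel execution does not execute $a$ as the node immediately before $b$. Every node accesses a finite sequence of memory blocks. Every processor has its own, initially empty, fully associative LRU cache with $C\ge 0$ lines. **Theorem.** For every $\kappa$ there is a constant $K$, depending on $\kappa$ only, such that for every structured single-touch computation of span $T_\infty$, every $P\ge 1$, and every $\kappa$-fair adaptive adversary, the future-thread-first parsimonious work-stealing execution with $P$ processors satisfies $$\mathbb{E}[\#\text{deviations}]\le K\,P\,T_\infty^2 ,$$ and, for every $C$ and every assignment of memory accesses to the nodes, $$\mathbb{E}[\#\text{cache misses}]\le M_{\mathrm{seq}}+K\,C\,P\,T_\infty^2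 ,$$ where the cache misses are counted over all processors and $M_{\mathrm{seq}}$ is the number of cache misses of the sequential execution with $C$ cache lines; that is, there are $O(PT_\infty^2)$ deviations and $O(CPT_\infty^2)$ additional cache misses in expectation. -/

import Mathlib

open MeasureTheory ProbabilityTheory
open scoped ENNReal

universe u v w

/-- A graph whose edges are sorted into the three kinds of edges of a future-parallel computation.
Every node has at most one outgoing edge of each kind, so that each kind is a partial function:
`next` gives the continuation edges, `future` the future (spawn) edges, `touch` the touch (join)
edges. -/
structure FutureGraph (V : Type u) where
  root : V
  final : V
  next : V → Option V
  future : V → Option V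
  touch : V → Option V

namespace FutureGraph

variable {V : Type u}

/-- `u → v` is a continuation edge. -/
def ContEdge (G : FutureGraph V) (u v : V) : Prop := G.next u = some v

/-- `u → v` is an edge of any kind. -/
def Edge (G : FutureGraph V) (u v : V) : Prop :=
  G.next u = some v ∨ G.future u = some v ∨ G.touch u = some v

/-- `v` is a descendant of `u`: there is a directed path with at least one edge from `u` to `v`. -/
def Desc (G : FutureGraph V) (u v : V) : Prop := Relation.TransGen G.Edge u v

/-- `v` is reached from `u` by continuation edges; if `u` is the first node of a thread, this says
that `v` belongs to that thread. -/
def InThread (G : FutureGraph V) (u v : V) : Prop := Relation.ReflTransGen G.ContEdge u v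

/-- The conventions for the computation DAG of a future-parallel computation. -/
structure IsComputationDAG (G : FutureGraph V) : Prop where
  acyclic : ∀ v, ¬ G.Desc v v
  /-- The root has in-degree 0. -/
  root_in : ∀ u, ¬ G.Edge u G.root
  /-- The final node has out-degree 0. -/
  final_out : ∀ v, ¬ G.Edge G.final v
  /-- Threads are chains, and a node has at most one incoming edge of each kind. -/
  next_inj : ∀ u v w, G.next u = some w → G.next v = some w → u = v
  future_inj : ∀ u v w, G.future u = some w → G.future v = some w → u = v
  touch_inj : ∀ u v w, G.touch u = some w → G.touch v = some w → u = v
  /-- The main thread starts at the root and ends at the final node. -/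
  main_thread : G.InThread G.root G.final
  /-- Every thread other than the main thread starts at a node with an incoming future edge. -/
  thread_start : ∀ v, v ≠ G.root → (∃ u, G.next u = some v) ∨ ∃ u, G.future u = some v
  /-- The last node of every thread other than the main thread has exactly one outgoing edge,
  which is a touch edge. -/
  thread_end : ∀ v, v ≠ G.final → G.next v = none → G.future v = none ∧ ∃ x, G.touch v = some x
  /-- A fork has exactly two outgoing edges: a future edge and a continuation edge. -/
  fork_out : ∀ v w, G.future v = some w → (∃ r, G.next v = some r) ∧ G.touch v = none
  /-- The left child of a fork is the first node of a thread, and has in-degree 1. -/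
  fork_left : ∀ v w, G.future v = some w → ∀ u, G.next u ≠ some w ∧ G.touch u ≠ some w
  /-- The right child of a fork has in-degree 1. -/
  fork_right : ∀ v w r, G.future v = some w → G.next v = some r → ∀ u, G.touch u ≠ some r
  /-- A touch edge is directed to another thread. -/
  touch_other : ∀ u x, G.touch u = some x → ¬ G.InThread u x
  /-- Only future threads are touched, the main thread is not. -/
  main_no_touch : ∀ u, G.InThread G.root u → G.touch u = none

/-- The node `x` is a touch of the thread whose first node is `w`. -/
def IsTouchOf (G : FutureGraph V) (w x : V) : Prop := ∃ u, G.InThread w u ∧ G.touch u = some x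

/-- Structured future-parallel computations. In both definitions below `v` is a fork, `w` is the
first node of the future thread spawned at `v`, and `r` is the right child of `v`. -/
structure IsStructured (G : FutureGraph V) : Prop extends G.IsComputationDAG where
  local_parent : ∀ v w r, G.future v = some w → G.next v = some r →
    ∀ x y, G.IsTouchOf w x → G.next y = some x → G.Desc v y
  exists_touch : ∀ v w r, G.future v = some w → G.next v = some r →
    ∃ x, G.IsTouchOf w x ∧ G.Desc r x

/-- Structured single-touch computations. -/
structure IsStructuredSingleTouch (G : FutureGraph V) : Prop extends G.IsStructured where
  single_touch : ∀ v w r, G.future v = some w → G.next v = some r →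
    (∃! x, G.IsTouchOf w x) ∧ ∀ x, G.IsTouchOf w x → G.Desc r x

/-- The computation span: the length (number of edges) of a longest directed path. -/
noncomputable def span (G : FutureGraph V) : ℕ :=
  sSup {n | ∃ l : List V, l.IsChain G.Edge ∧ l.length = n + 1}

end FutureGraph

/-- The state of `P` processors: the node that each processor is about to execute, its deque
(the head of the list is the bottom, the last entry is the top), and the nodes that it has executed
so far, in the order of execution. -/
structure WSState (V : Type u) (P : ℕ) where
  current : Fin P → Option V
  deque : Fin P → List V
  history : Fin P → List V

namespace WSState

variable {V : Type u} {P : ℕ}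

/-- At the start processor `p₀` is about to execute the root, and nothing else is there. -/
def init (G : FutureGraph V) (p₀ : Fin P) : WSState V P where
  current := Function.update (fun _ => none) p₀ (some G.root)
  deque := fun _ => []
  history := fun _ => []

def Executed (s : WSState V P) (v : V) : Prop := ∃ p, v ∈ s.history p

/-- The next action of `p` will be an attempt to steal. -/
def WantsToSteal (s : WSState V P) (p : Fin P) : Prop := s.current p = none ∧ s.deque p = []

open Classical in
/-- The children of `v` all of whose parents have been executed, with the future child first. -/
noncomputable def readyChildren (G : FutureGraph V) (s : WSState V P) (v : V) : List V :=
  ((G.future v).toList ++ (G.touch v).toList ++ (G.next v).toList).filter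
    (fun c => decide (∀ a, G.Edge a c → s.Executed a))

/-- One action of processor `p`; `r` is the victim if this action is an attempt to steal.
* If `p` has a node to execute, it executes it and goes on with the first ready child (at a fork
  the future child); another ready child (at a fork the right child) is pushed onto the bottom of
  the deque of `p`.
* If `p` has no node to execute and its deque is not empty, it pops the bottom node.
* If `p` has no node to execute and its deque is empty, it steals the top node of the deque of `r`;
  the attempt fails if that deque is empty. -/
noncomputable def step (G : FutureGraph V) (s : WSState V P) (p r : Fin P) : WSState V P :=
  match s.current p with
  | some v =>
    let s' : WSState V P :=
      { s with history := Function.update s.history p (s.history p ++ [v]) }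
    let c := readyChildren G s' v
    { s' with
      current := Function.update s.current p c.head?
      deque := Function.update s.deque p (c.tail ++ s.deque p) }
  | none =>
    match s.deque p with
    | a :: d =>
      { s with
        current := Function.update s.current p (some a)
        deque := Function.update s.deque p d }
    | [] =>
      match (s.deque r).getLast? with
      | some a =>
        { s with
          current := Function.update s.current p (some a)
          deque := Function.update s.deque r (s.deque r).dropLast }
      | none => s

end WSState

/-- An adaptive scheduler (adversary): it chooses the processor that acts at time `n`, and may look
at all the random draws made before time `n` (they determine the state at time `n`). -/
abbrev Scheduler (P : ℕ) := (n : ℕ) → (Fin n → Fin P) → Fin P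

namespace WorkStealing

variable {V : Type u} {P : ℕ}

/-- The processor that acts at time `n`, for the sequence `x` of random draws. -/
def actor (A : Scheduler P) (x : ℕ → Fin P) (n : ℕ) : Fin P := A n (fun i => x i)

/-- The state at time `n` of the work-stealing execution which starts at processor `p₀`, in which
the processors act as `A` says and the victim of an attempt to steal at time `n` is `x n`. -/
noncomputable def run (G : FutureGraph V) (p₀ : Fin P) (A : Scheduler P) (x : ℕ → Fin P) :
    ℕ → WSState V P
  | 0 => WSState.init G p₀
  | n + 1 => (run G p₀ A x n).step G (actor A x n) (x n)

/-- At time `n` processor `p` attempts to steal. -/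
def StealAttempt (G : FutureGraph V) (p₀ : Fin P) (A : Scheduler P) (x : ℕ → Fin P)
    (p : Fin P) (n : ℕ) : Prop :=
  actor A x n = p ∧ (run G p₀ A x n).WantsToSteal p

/-- In every time interval in which some processor makes more than `κ` attempts to steal, every
processor acts at least once. -/
def IsFair (κ : ℕ) (G : FutureGraph V) (p₀ : Fin P) (A : Scheduler P) : Prop :=
  ∀ (x : ℕ → Fin P) (p : Fin P) (i j : ℕ),
    κ < {n | i ≤ n ∧ n < j ∧ StealAttempt G p₀ A x p n}.ncard →
    ∀ q, ∃ n, i ≤ n ∧ n < j ∧ actor A x n = q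

/-- The processor `p` executes `b`, and `a` is the node that it executes immediately before. -/
def ExecutesAfter (G : FutureGraph V) (p₀ : Fin P) (A : Scheduler P) (x : ℕ → Fin P)
    (p : Fin P) (a b : V) : Prop :=
  ∃ n, [a, b] <:+: (run G p₀ A x n).history p

/-- In the sequential (one-processor, future thread first) execution, `a` is executed immediately
before `b`. -/
def SeqBefore (G : FutureGraph V) (a b : V) : Prop :=
  ExecutesAfter (P := 1) G 0 (fun _ _ => 0) (fun _ => 0) 0 a b

/-- `b` is a deviation: it is executed, but not by a processor that executes it immediately after
the node that precedes `b` in the sequential execution. -/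
def IsDeviation (G : FutureGraph V) (p₀ : Fin P) (A : Scheduler P) (x : ℕ → Fin P) (b : V) : Prop :=
  (∃ n, (run G p₀ A x n).Executed b) ∧
    ∃ a, SeqBefore G a b ∧ ∀ p, ¬ ExecutesAfter G p₀ A x p a b

/-- The number of deviations of an execution. -/
noncomputable def deviations (G : FutureGraph V) (p₀ : Fin P) (A : Scheduler P)
    (x : ℕ → Fin P) : ℕ :=
  {b | IsDeviation G p₀ A x b}.ncard

open Classical in
/-- The number of misses of a fully associative LRU cache with `C` lines on a sequence of memory
accesses; the first list is the content of the cache, most recently used block first. -/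
noncomputable def lruMisses {B : Type v} (C : ℕ) : List B → List B → ℕ
  | _, [] => 0
  | cache, b :: bs =>
    (if b ∈ cache then 0 else 1) + lruMisses C ((b :: cache.erase b).take C) bs

/-- The total number of cache misses of an execution, over all processors. Each processor has a
cache of its own with `C` lines, empty at the start; `acc v` lists the memory blocks that are
accessed by the instructions of `v`, in the order of access. -/
noncomputable def misses {B : Type v} (C : ℕ) (acc : V → List B) (G : FutureGraph V)
    (p₀ : Fin P) (A : Scheduler P) (x : ℕ → Fin P) : ℝ≥0∞ :=
  ⨆ n, ((∑ p, lruMisses C [] (((run G p₀ A x n).history p).flatMap acc) : ℕ) : ℝ≥0∞)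

/-- The number of cache misses of the sequential (future thread first) execution. -/
noncomputable def seqMisses {B : Type v} (C : ℕ) (acc : V → List B) (G : FutureGraph V) : ℝ≥0∞ :=
  misses (P := 1) C acc G 0 (fun _ _ => 0) (fun _ => 0)

end WorkStealing

/-!
The theorem bounds the deviations by the steals, and then the steals by a potential.

*Deviations.* Depth-first execution visits `b` immediately after `a` only if `b` is the left child
of the fork `a`, or the successor of `a` in its thread, or the right child of the fork whose future
thread ends with `a` (`FutureGraph.SeqStep`). The structure of the computation enters through one
fact, `not_reach_of_tree`: the right child of a fork reaches no node that is spawned, directly or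
indirectly, by the future thread of the fork. Hence it reaches the local parent of the touch of this
thread (`reach_local_parent`). It follows that in every execution the nodes at hand of a processor
are nested (`WSState.Inv.stack`): the node to be executed lies in the future thread of the fork
whose right child is at the bottom of the deque, and so on to the top. A right child `r` of a fork
`v` is therefore popped either immediately after the last node of the future thread of `v`, as in the
sequential order, or when the processor is blocked in this thread, at the local parent of the touch
of a future thread that is not finished, say that of `d`. Then `d` is late, and the right child of
`d` has itself left its deque too early. So the forks at which something goes wrong form chains: the
first right child has been stolen, and the future thread of each fork is touched by that of the next
one. The touch of a thread is unique, so that the chain is determined by its first fork, and its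
length is at most the span since the last nodes of the threads lie on a directed path
(`Disturbed.exists_chain`). Each of these forks accounts for two deviations at most, its right child
and the touch of its future thread, which gives at most `2 * T * S` deviations, for span `T` and `S`
steals (`WorkStealing.ncard_exceptional_le`).

*Cache misses.* Between deviations a processor executes nodes in the sequential order, and two LRU
caches with `C` lines differ by at most `C` misses on the same sequence of accesses
(`lruMisses_le_add`). So every deviation costs at most `C` additional misses (`sum_lruMisses_le`).

*Steals.* Give a node of depth `d` the weight `9 ^ (T - d)`, three times as much while it is in a
deque. By the nesting the top of a deque carries a constant part of the potential of its processor.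
In a round of `P * (κ + 1)` attempts to steal, every top node is hit with constant probability, and
by fairness every processor acts. So the expected potential decreases by a constant factor in each
round. The average is taken action by action, without stopping times: the potential less the
decrease that is still to be expected in the current round (`restPotential`) is a supermartingale,
and so is `WorkStealing.charge`, in which it is compensated by a factor for each earlier round.
Hence the expected number of rounds is `O(T + 1)`, and that of the steals is `O(P (T + 1))`
(`lintegral_iSup_steals_le`).
-/

namespace FutureGraph

variable {V : Type u} {G : FutureGraph V}

/-! ### Depth -/

theorem nodup_of_isChain_edge (hac : ∀ v, ¬ G.Desc v v) {l : List V} (hl : l.IsChain G.Edge) :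
    l.Nodup := by
  have h1 : l.IsChain (Relation.TransGen G.Edge) := hl.imp fun a b h => Relation.TransGen.single h
  have h2 : l.Pairwise (Relation.TransGen G.Edge) := List.isChain_iff_pairwise.1 h1
  exact h2.imp fun {a b} hab (e : a = b) => hac a (by rw [← e] at hab; exact hab)

/-- The length (number of edges) of a longest directed path that ends at `v`. -/
noncomputable def depth (G : FutureGraph V) (v : V) : ℕ :=
  sSup {n | ∃ l : List V, l.IsChain G.Edge ∧ l.getLast? = some v ∧ l.length = n + 1}

section Depth

variable [Finite V] (hac : ∀ v, ¬ G.Desc v v)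
include hac

theorem length_le_of_isChain_edge {l : List V} (hl : l.IsChain G.Edge) :
    l.length ≤ Nat.card V := by
  classical
  have := Fintype.ofFinite V
  rw [Nat.card_eq_fintype_card]
  exact (nodup_of_isChain_edge hac hl).length_le_card

theorem bddAbove_depth (v : V) : BddAbove {n | ∃ l : List V, l.IsChain G.Edge ∧
    l.getLast? = some v ∧ l.length = n + 1} :=
  ⟨Nat.card V, by
    rintro n ⟨l, hl, -, hn⟩
    have := length_le_of_isChain_edge hac hl
    omega⟩

theorem le_depth {l : List V} {v : V} (hl : l.IsChain G.Edge) (hv : l.getLast? = some v) :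
    l.length ≤ G.depth v + 1 := by
  cases l with
  | nil => simp
  | cons a l =>
    have : l.length ≤ G.depth v := le_csSup (bddAbove_depth hac v) ⟨a :: l, hl, hv, by simp⟩
    simpa using this

theorem exists_chain_depth (v : V) :
    ∃ l : List V, l.IsChain G.Edge ∧ l.getLast? = some v ∧ l.length = G.depth v + 1 :=
  Nat.sSup_mem (s := {n | ∃ l : List V, l.IsChain G.Edge ∧ l.getLast? = some v ∧
    l.length = n + 1}) ⟨0, [v], by simp, by simp, by simp⟩ (bddAbove_depth hac v)

theorem depth_le_span (v : V) : G.depth v ≤ G.span := by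
  obtain ⟨l, h1, -, h3⟩ := exists_chain_depth hac v
  refine le_csSup ⟨Nat.card V, ?_⟩ ⟨l, h1, h3⟩
  rintro n ⟨l, hl, hn⟩
  have := length_le_of_isChain_edge hac hl
  omega

theorem depth_lt_of_edge {u v : V} (h : G.Edge u v) : G.depth u < G.depth v := by
  obtain ⟨l, h1, h2, h3⟩ := exists_chain_depth hac u
  have h4 : (l ++ [v]).IsChain G.Edge := by
    refine h1.append (by simp) ?_
    intro x hx y hy
    simp only [h2, Option.mem_def, Option.some.injEq] at hx
    simp at hy
    subst hx hy
    exact h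
  have := le_depth hac (v := v) h4 (by simp)
  simp at this
  omega

theorem depth_le_of_forall_edge {u v : V} (h : ∀ a, G.Edge a v → a = u) :
    G.depth v ≤ G.depth u + 1 := by
  obtain ⟨l, h1, h2, h3⟩ := exists_chain_depth hac v
  rcases List.eq_nil_or_concat l with rfl | ⟨l', b, rfl⟩
  · simp at h3
  simp only [List.concat_eq_append, List.getLast?_append, List.getLast?_singleton,
    Option.some_or, Option.some.injEq] at h1 h2 h3
  subst h2
  rcases List.eq_nil_or_concat l' with rfl | ⟨l', a, rfl⟩
  · simp at h3
    omega
  simp only [List.concat_eq_append] at *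
  have hab : G.Edge a b := by
    rw [List.append_assoc] at h1
    have := (List.isChain_append.1 h1).2.1
    simpa using this
  have := le_depth hac (v := a) (List.isChain_append.1 h1).1 (by simp)
  rw [h a hab] at this
  simp at h3 this
  omega

theorem depth_le_of_reach {u v : V} (h : Relation.ReflTransGen G.Edge u v) :
    G.depth u ≤ G.depth v := by
  induction h with
  | refl => exact le_rfl
  | tail _ h ih => exact ih.trans (depth_lt_of_edge hac h).le

end Depth

/-! ### Threads -/

/-- There is a directed path, possibly without edges, from `u` to `v`. -/
def Reach (G : FutureGraph V) (u v : V) : Prop := Relation.ReflTransGen G.Edge u v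

/-- The node `a` belongs to the future thread spawned at the fork `v`. -/
def Spawned (G : FutureGraph V) (v a : V) : Prop := ∃ w, G.future v = some w ∧ G.InThread w a

/-- The node `r` is the right child of a fork. -/
def IsRight (G : FutureGraph V) (r : V) : Prop := ∃ v w, G.future v = some w ∧ G.next v = some r

/-- The node `r` is the right child of a fork whose future thread contains `a`. -/
def Under (G : FutureGraph V) (r a : V) : Prop := ∃ v, G.next v = some r ∧ G.Spawned v a

/-- The spawn tree: every node other than the root has one incoming continuation or future edge. -/
def TreeEdge (G : FutureGraph V) (u v : V) : Prop := G.next u = some v ∨ G.future u = some v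

theorem TreeEdge.edge {u v : V} (h : G.TreeEdge u v) : G.Edge u v := by
  rcases h with h | h
  · exact Or.inl h
  · exact Or.inr (Or.inl h)

theorem reach_of_tree {u v : V} (h : Relation.ReflTransGen G.TreeEdge u v) : G.Reach u v :=
  Relation.ReflTransGen.mono (fun _ _ h => TreeEdge.edge h) _ _ h

theorem InThread.tree {u v : V} (h : G.InThread u v) : Relation.ReflTransGen G.TreeEdge u v :=
  Relation.ReflTransGen.mono (fun _ _ h => Or.inl h) _ _ h

theorem InThread.reach {u v : V} (h : G.InThread u v) : G.Reach u v := reach_of_tree h.tree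

theorem Reach.depth_le [Finite V] (hac : ∀ v, ¬ G.Desc v v) {u v : V} (h : G.Reach u v) :
    G.depth u ≤ G.depth v := depth_le_of_reach hac h

theorem Spawned.step {v a b : V} (h : G.Spawned v a) (hab : G.next a = some b) :
    G.Spawned v b := by
  obtain ⟨w, hw, ha⟩ := h
  exact ⟨w, hw, ha.tail hab⟩

theorem Under.step {r a b : V} (h : G.Under r a) (hab : G.next a = some b) : G.Under r b := by
  obtain ⟨v, hv, ha⟩ := h
  exact ⟨v, hv, ha.step hab⟩

namespace IsStructuredSingleTouch

variable (h : G.IsStructuredSingleTouch)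
include h

/-- Going backwards along a future thread. -/
theorem inThread_pred {v w a b : V} (hw : G.future v = some w) (hb : G.InThread w b)
    (hab : G.next a = some b) : G.InThread w a := by
  rcases Relation.ReflTransGen.cases_tail hb with e | ⟨a', ha', h'⟩
  · subst e
    exact absurd hab (h.fork_left v _ hw a).1
  · rwa [h.next_inj a a' b hab h']

theorem spawned_pred {v a b : V} (hb : G.Spawned v b) (hab : G.next a = some b) :
    G.Spawned v a := by
  obtain ⟨w, hw, hb⟩ := hb
  exact ⟨w, hw, h.inThread_pred hw hb hab⟩

theorem spawned_unique {v v' a : V} (h1 : G.Spawned v a) (h2 : G.Spawned v' a) : v = v' := by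
  obtain ⟨w, hw, ha⟩ := h1
  obtain ⟨w', hw', ha'⟩ := h2
  suffices w = w' by subst this; exact h.future_inj _ _ _ hw hw'
  induction ha with
  | refl =>
    rcases Relation.ReflTransGen.cases_tail ha' with e | ⟨b, hb, hb'⟩
    · exact e
    · exact absurd hb' (h.fork_left v _ hw b).1
  | tail _ hbc ih => exact ih (h.inThread_pred hw' ha' hbc)

theorem mem_main_or_spawned [Finite V] (a : V) : G.InThread G.root a ∨ ∃ v, G.Spawned v a := by
  induction hn : G.depth a using Nat.strong_induction_on generalizing a with
  | _ n ih =>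
    subst hn
    by_cases ha : a = G.root
    · left; rw [ha]; exact Relation.ReflTransGen.refl
    rcases h.thread_start a ha with ⟨u, hu⟩ | ⟨u, hu⟩
    · rcases ih _ (depth_lt_of_edge h.acyclic (Or.inl hu)) u rfl with hm | ⟨v, hv⟩
      · exact Or.inl (hm.tail hu)
      · exact Or.inr ⟨v, hv.step hu⟩
    · exact Or.inr ⟨u, a, hu, Relation.ReflTransGen.refl⟩

theorem exists_spawned_of_touch [Finite V] {z x : V} (hz : G.touch z = some x) :
    ∃ v, G.Spawned v z := by
  rcases h.mem_main_or_spawned z with hm | hs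
  · simp [h.main_no_touch z hm] at hz
  · exact hs

theorem next_of_future {v w : V} (hv : G.future v = some w) : ∃ r, G.next v = some r :=
  (h.fork_out v w hv).1

theorem future_none_of_touch {z x : V} (hz : G.touch z = some x) : G.future z = none := by
  by_contra hc
  obtain ⟨w, hw⟩ := Option.ne_none_iff_exists'.1 hc
  simp [(h.fork_out z w hw).2] at hz

/-- A future thread has only one outgoing touch edge. -/
theorem touch_unique {v z z' x x' : V} (h1 : G.Spawned v z) (h2 : G.Spawned v z')
    (hz : G.touch z = some x) (hz' : G.touch z' = some x') : z = z' := by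
  obtain ⟨w, hw, ha⟩ := h1
  obtain ⟨w', hw', ha'⟩ := h2
  rw [hw] at hw'
  cases hw'
  obtain ⟨r, hr⟩ := h.next_of_future hw
  have := (h.single_touch v w r hw hr).1.unique ⟨z, ha, hz⟩ ⟨z', ha', hz'⟩
  subst this
  exact h.touch_inj _ _ _ hz hz'

theorem exists_last {v w : V} (hv : G.future v = some w) :
    ∃ z x, G.Spawned v z ∧ G.touch z = some x := by
  obtain ⟨r, hr⟩ := h.next_of_future hv
  obtain ⟨x, ⟨z, h1, h2⟩, -⟩ := h.exists_touch v w r hv hr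
  exact ⟨z, x, ⟨w, hv, h1⟩, h2⟩

theorem desc_touch {v z x r : V} (hs : G.Spawned v z) (hz : G.touch z = some x)
    (hr : G.next v = some r) : G.Desc r x := by
  obtain ⟨w, hw, ha⟩ := hs
  exact (h.single_touch v w r hw hr).2 x ⟨z, ha, hz⟩

theorem ne_root_of_edge {a b : V} (hab : G.Edge a b) : b ≠ G.root := by
  rintro rfl
  exact h.root_in a hab

/-- A touch has a local parent. -/
theorem exists_local_parent {z x : V} (hz : G.touch z = some x) : ∃ y, G.next y = some x := by
  rcases h.thread_start x (h.ne_root_of_edge (Or.inr (Or.inr hz))) with hu | ⟨u, hu⟩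
  · exact hu
  · exact absurd hz (h.fork_left u x hu z).2

theorem not_main_of_spawned {v a : V} (hs : G.Spawned v a) : ¬ G.InThread G.root a := by
  obtain ⟨w, hw, ha⟩ := hs
  intro hm
  induction ha with
  | refl =>
    rcases Relation.ReflTransGen.cases_tail hm with e | ⟨b, -, hb⟩
    · exact h.root_in v (Or.inr (Or.inl (e ▸ hw)))
    · exact (h.fork_left v w hw b).1 hb
  | @tail b c _ hbc ih =>
    apply ih
    rcases Relation.ReflTransGen.cases_tail hm with e | ⟨b', hb, hb'⟩
    · exact absurd (Or.inl (e ▸ hbc)) (h.root_in b)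
    · rwa [h.next_inj b b' c hbc hb']

theorem ne_final_of_spawned {v a : V} (hs : G.Spawned v a) : a ≠ G.final := by
  rintro rfl
  exact h.not_main_of_spawned hs h.main_thread

/-- The nodes below a node of a future thread all belong to it, up to its last node, which has the
outgoing touch edge. -/
theorem exists_inThread_touch [Finite V] {v a : V} (hs : G.Spawned v a) :
    ∃ z x, G.InThread a z ∧ G.Spawned v z ∧ G.touch z = some x ∧ G.next z = none := by
  induction hn : G.span - G.depth a using Nat.strong_induction_on generalizing a with
  | _ n ih =>
    subst hn
    cases hb : G.next a with
    | none =>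
      obtain ⟨-, x, hx⟩ := h.thread_end a (h.ne_final_of_spawned hs) hb
      exact ⟨a, x, Relation.ReflTransGen.refl, hs, hx, hb⟩
    | some b =>
      have h1 := depth_lt_of_edge h.acyclic (Or.inl hb : G.Edge a b)
      have h2 := depth_le_span h.acyclic b
      obtain ⟨z, x, h3, h4⟩ := ih _ (by omega) (hs.step hb) rfl
      exact ⟨z, x, h3.head hb, h4⟩

theorem next_none_of_touch [Finite V] {z x : V} (hz : G.touch z = some x) : G.next z = none := by
  obtain ⟨v, hv⟩ := h.exists_spawned_of_touch hz
  obtain ⟨z', x', h1, h2, h3, h4⟩ := h.exists_inThread_touch hv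
  rwa [h.touch_unique hv h2 hz h3]

theorem touch_none_of_next [Finite V] {a b : V} (hab : G.next a = some b) : G.touch a = none := by
  by_contra hc
  obtain ⟨x, hx⟩ := Option.ne_none_iff_exists'.1 hc
  simp [h.next_none_of_touch hx] at hab

theorem depth_left [Finite V] {v w : V} (hv : G.future v = some w) :
    G.depth w = G.depth v + 1 := by
  refine le_antisymm (depth_le_of_forall_edge h.acyclic ?_)
    (depth_lt_of_edge h.acyclic (Or.inr (Or.inl hv)))
  rintro a (ha | ha | ha)
  · exact absurd ha (h.fork_left v w hv a).1
  · exact h.future_inj _ _ _ ha hv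
  · exact absurd ha (h.fork_left v w hv a).2

theorem depth_right [Finite V] {v w r : V} (hv : G.future v = some w) (hr : G.next v = some r) :
    G.depth r = G.depth v + 1 := by
  refine le_antisymm (depth_le_of_forall_edge h.acyclic ?_)
    (depth_lt_of_edge h.acyclic (Or.inl hr))
  rintro a (ha | ha | ha)
  · exact h.next_inj _ _ _ ha hr
  · exact absurd hr (h.fork_left a r ha v).1
  · exact absurd ha (h.fork_right v w r hv hr a)

theorem depth_le_of_under [Finite V] {r a : V} (hra : G.Under r a) : G.depth r ≤ G.depth a := by
  obtain ⟨v, hr, w, hw, ha⟩ := hra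
  rw [h.depth_right hw hr, ← h.depth_left hw]
  exact ha.reach.depth_le h.acyclic

theorem depth_lt_of_under_isRight [Finite V] {r a : V} (hra : G.Under r a) (ha : G.IsRight a) :
    G.depth r < G.depth a := by
  obtain ⟨v, w, hv, hva⟩ := ha
  obtain ⟨v', hr, hs⟩ := hra
  have h1 := h.depth_le_of_under ⟨v', hr, h.spawned_pred hs hva⟩
  have h2 := h.depth_right hv hva
  omega

/-! ### The right child of a fork does not reach the spawned computation -/

/-- Follow a path from the successor `r` of a node `v` in its thread backwards from a node `m` of a
future thread whose fork is not reached from `r`. The path enters threads by touch edges only, until it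
comes to the thread of `r`; if that thread is not the thread of `m`, then the path leaves it by its
touch edge, so that the right child of the fork of the thread of `v` also reaches `m`. -/
theorem inThread_or_escalate [Finite V] {v r : V} (hr : G.next v = some r)
    {va wa m : V} (ha : G.future va = some wa) (hm : G.InThread wa m)
    (hrm : G.Reach r m) (hva : ¬ G.Reach r va) :
    G.InThread wa r ∨ ∃ vq wq rq, G.future vq = some wq ∧ G.next vq = some rq ∧
      G.InThread wq v ∧ G.Reach rq m := by
  induction hn : G.depth m using Nat.strong_induction_on generalizing va wa m with
  | _ n ih =>
    subst hn
    rcases Relation.ReflTransGen.cases_tail hrm with e | ⟨m', hrm', hm'⟩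
    · exact Or.inl (e ▸ hm)
    have key : ∀ y, G.next y = some m → G.Reach r y → G.InThread wa r ∨ ∃ vq wq rq,
        G.future vq = some wq ∧ G.next vq = some rq ∧ G.InThread wq v ∧ G.Reach rq m := by
      intro y hy hry
      rcases ih _ (depth_lt_of_edge h.acyclic (Or.inl hy)) ha (h.inThread_pred ha hm hy) hry hva rfl
        with h1 | ⟨vq, wq, rq, h1, h2, h3, h4⟩
      · exact Or.inl h1
      · exact Or.inr ⟨vq, wq, rq, h1, h2, h3, h4.tail (Or.inl hy)⟩
    rcases hm' with hm' | hm' | hm'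
    · exact key m' hm' hrm'
    · rcases Relation.ReflTransGen.cases_tail hm with e | ⟨b, -, hb⟩
      · subst e
        rw [h.future_inj _ _ _ ha hm'] at hva
        exact absurd hrm' hva
      · exact absurd hb (h.fork_left m' m hm' b).1
    · obtain ⟨y, hy⟩ := h.exists_local_parent hm'
      by_cases hry : G.Reach r y
      · exact key y hy hry
      obtain ⟨vb, hvb⟩ := h.exists_spawned_of_touch hm'
      have hvb' := hvb
      obtain ⟨wb, hwb, hbm⟩ := hvb'
      obtain ⟨rb, hrb⟩ := h.next_of_future hwb
      have hd : G.Desc vb y := h.local_parent vb wb rb hwb hrb m y ⟨m', hbm, hm'⟩ hy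
      rcases ih _ (depth_lt_of_edge h.acyclic (Or.inr (Or.inr hm'))) hwb hbm hrm'
        (fun hc => hry (hc.trans hd.to_reflTransGen)) rfl with h1 | ⟨vq, wq, rq, h1, h2, h3, h4⟩
      · exact Or.inr ⟨vb, wb, rb, hwb, hrb, h.inThread_pred hwb h1 hr,
          (h.desc_touch hvb hm' hrb).to_reflTransGen⟩
      · exact Or.inr ⟨vq, wq, rq, h1, h2, h3, h4.tail (Or.inr (Or.inr hm'))⟩

/-- No node that is spawned, directly or indirectly, by the future thread of a fork is reached from
the right child of the fork. A path from the right child would lead, by `inThread_or_escalate`, to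
such a path for the fork that spawns the thread of the given fork. -/
theorem not_reach_of_tree [Finite V] {v w r n : V} (hv : G.future v = some w)
    (hr : G.next v = some r) (hn : Relation.ReflTransGen G.TreeEdge w n) : ¬ G.Reach r n := by
  induction hd : G.depth v using Nat.strong_induction_on generalizing v w r n with
  | _ d ih =>
    subst hd
    have cyc : ∀ {a b : V}, G.Edge a b → ¬ G.Reach b a := fun {a b} hab hba =>
      h.acyclic a (Relation.TransGen.head' hab hba)
    induction hn with
    | refl =>
      intro hrw
      rcases Relation.ReflTransGen.cases_tail hrw with e | ⟨m', hrm', hm'⟩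
      · exact (h.fork_left v w hv v).1 (e ▸ hr)
      rcases hm' with hm' | hm' | hm'
      · exact (h.fork_left v w hv m').1 hm'
      · rw [h.future_inj _ _ _ hm' hv] at hrm'
        exact cyc (Or.inl hr) hrm'
      · exact (h.fork_left v w hv m').2 hm'
    | @tail m n hwm hmn ihm =>
      intro hrn
      rcases Relation.ReflTransGen.cases_tail hrn with e | ⟨m', hrm', hm'⟩
      · subst e
        rcases hmn with hmn | hmn
        · rw [h.next_inj _ _ _ hmn hr] at hwm
          exact cyc (Or.inr (Or.inl hv)) (reach_of_tree hwm)
        · exact (h.fork_left m n hmn v).1 hr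
      rcases hmn with hmn | hmn
      swap
      · rcases hm' with hm' | hm' | hm'
        · exact (h.fork_left m n hmn m').1 hm'
        · exact ihm (h.future_inj _ _ _ hm' hmn ▸ hrm')
        · exact (h.fork_left m n hmn m').2 hm'
      rcases hm' with hm' | hm' | hm'
      · exact ihm (h.next_inj _ _ _ hm' hmn ▸ hrm')
      · exact (h.fork_left m' n hm' m).1 hmn
      obtain ⟨vb, hvb⟩ := h.exists_spawned_of_touch hm'
      have hvb' := hvb
      obtain ⟨wb, hwb, hbm⟩ := hvb'
      obtain ⟨rb, hrb⟩ := h.next_of_future hwb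
      have hd : G.Desc vb m := h.local_parent vb wb rb hwb hrb n m ⟨m', hbm, hm'⟩ hmn
      have esc : ∃ vq wq rq, G.future vq = some wq ∧ G.next vq = some rq ∧
          G.InThread wq v ∧ G.Reach rq n := by
        rcases h.inThread_or_escalate hr hwb hbm hrm'
          (fun hc => ihm (hc.trans hd.to_reflTransGen)) with h1 | ⟨vq, wq, rq, h1, h2, h3, h4⟩
        · exact ⟨vb, wb, rb, hwb, hrb, h.inThread_pred hwb h1 hr,
            (h.desc_touch hvb hm' hrb).to_reflTransGen⟩
        · exact ⟨vq, wq, rq, h1, h2, h3, h4.tail (Or.inr (Or.inr hm'))⟩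
      obtain ⟨vq, wq, rq, h1, h2, h3, h4⟩ := esc
      have hlt : G.depth vq < G.depth v :=
        (depth_lt_of_edge h.acyclic (Or.inr (Or.inl h1))).trans_le (h3.reach.depth_le h.acyclic)
      exact ih _ hlt h1 h2
        (((h3.tree.tail (Or.inr hv)).trans hwm).tail (Or.inl hmn)) rfl h4

/-- The local parent of the touch of a future thread is reached from the right child of the fork
at which the thread is spawned. -/
theorem reach_local_parent [Finite V] {v z x y r : V} (hs : G.Spawned v z)
    (hz : G.touch z = some x) (hy : G.next y = some x) (hr : G.next v = some r) :
    G.Reach r y := by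
  have hd := h.desc_touch hs hz hr
  obtain ⟨w, hw, ha⟩ := hs
  obtain ⟨m, hrm, hm⟩ := Relation.TransGen.tail'_iff.1 hd
  rcases hm with hm | hm | hm
  · rwa [h.next_inj _ _ _ hm hy] at hrm
  · exact absurd hz (h.fork_left m x hm z).2
  · rw [h.touch_inj _ _ _ hm hz] at hrm
    exact absurd hrm (h.not_reach_of_tree hw hr ha.tree)

end IsStructuredSingleTouch

end FutureGraph

/-! ### The steps of an execution -/

namespace WSState

variable {V : Type u} {P : ℕ} {G : FutureGraph V}

/-- The nodes that `p` has at hand: the node that it is about to execute, and its deque from the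
bottom to the top. -/
def pending (s : WSState V P) (p : Fin P) : List V := (s.current p).toList ++ s.deque p

/-- The state after processor `p` has executed `v`, where `c` lists the children that are enabled by
`v`. -/
def execute (s : WSState V P) (p : Fin P) (v : V) (c : List V) : WSState V P where
  current := Function.update s.current p c.head?
  deque := Function.update s.deque p (c.tail ++ s.deque p)
  history := Function.update s.history p (s.history p ++ [v])

/-- The state after processor `p` has popped `a` from its deque, and `d` has remained there. -/
def pop (s : WSState V P) (p : Fin P) (a : V) (d : List V) : WSState V P where
  current := Function.update s.current p (some a)
  deque := Function.update s.deque p d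
  history := s.history

/-- The state after processor `p` has stolen `a` from `r`. -/
def steal (s : WSState V P) (p r : Fin P) (a : V) : WSState V P where
  current := Function.update s.current p (some a)
  deque := Function.update s.deque r (s.deque r).dropLast
  history := s.history

/-- Every parent of `c` has been executed. -/
def Ready (G : FutureGraph V) (s : WSState V P) (c : V) : Prop := ∀ a, G.Edge a c → s.Executed a

theorem executed_execute {s : WSState V P} {p : Fin P} {v : V} {c : List V} {b : V} :
    (s.execute p v c).Executed b ↔ s.Executed b ∨ b = v := by
  simp only [Executed, execute]
  constructor
  · rintro ⟨q, hq⟩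
    by_cases hqp : q = p
    · subst hqp
      simp only [Function.update_self, List.mem_append, List.mem_singleton] at hq
      exact hq.imp (fun h => ⟨q, h⟩) id
    · rw [Function.update_of_ne hqp] at hq
      exact Or.inl ⟨q, hq⟩
  · rintro (⟨q, hq⟩ | rfl)
    · refine ⟨q, ?_⟩
      by_cases hqp : q = p
      · subst hqp
        simp [hq]
      · rwa [Function.update_of_ne hqp]
    · exact ⟨p, by simp⟩

theorem executed_pop {s : WSState V P} {p : Fin P} {a b : V} {d : List V} :
    (s.pop p a d).Executed b ↔ s.Executed b := Iff.rfl

theorem executed_steal {s : WSState V P} {p r : Fin P} {a b : V} :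
    (s.steal p r a).Executed b ↔ s.Executed b := Iff.rfl

/-- What the children enabled by the execution of `v` can be: both children of a fork, or the only
child, or none. The state `s` is the state after the execution. -/
inductive Enabled (G : FutureGraph V) (s : WSState V P) (v : V) : List V → Prop
  | fork (w r : V) : G.future v = some w → G.next v = some r → Enabled G s v [w, r]
  | next (b : V) : G.future v = none → G.next v = some b → s.Ready G b → Enabled G s v [b]
  | touch (x : V) : G.touch v = some x → s.Ready G x → Enabled G s v [x]
  | none : G.future v = none → (∀ b, G.Edge v b → ¬ s.Ready G b) → Enabled G s v []

open Classical in
theorem enabled_readyChildren [Finite V] (h : G.IsStructuredSingleTouch) {s : WSState V P} {v : V}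
    (hv : s.Executed v) : Enabled G s v (readyChildren G s v) := by
  unfold readyChildren
  cases hw : G.future v with
  | some w =>
    obtain ⟨⟨r, hr⟩, ht⟩ := h.fork_out v w hw
    have h1 : ∀ a, G.Edge a w → s.Executed a := by
      rintro a (ha | ha | ha)
      · exact absurd ha (h.fork_left v w hw a).1
      · rwa [h.future_inj _ _ _ ha hw]
      · exact absurd ha (h.fork_left v w hw a).2
    have h2 : ∀ a, G.Edge a r → s.Executed a := by
      rintro a (ha | ha | ha)
      · rwa [h.next_inj _ _ _ ha hr]
      · exact absurd hr (h.fork_left a r ha v).1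
      · exact absurd ha (h.fork_right v w r hw hr a)
    have : List.filter (fun c => decide (∀ a, G.Edge a c → s.Executed a)) [w, r] = [w, r] := by
      rw [List.filter_eq_self]
      intro c hc
      simp only [List.mem_cons, List.not_mem_nil, or_false] at hc
      rcases hc with rfl | rfl
      · exact decide_eq_true h1
      · exact decide_eq_true h2
    rw [ht, hr]
    simp only [Option.toList_some, Option.toList_none, List.append_nil, List.singleton_append]
    rw [this]
    exact .fork w r hw hr
  | none =>
    cases ht : G.touch v with
    | some x =>
      rw [h.next_none_of_touch ht]
      simp only [Option.toList_some, Option.toList_none, List.append_nil, List.nil_append]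
      by_cases hx : ∀ a, G.Edge a x → s.Executed a
      · rw [List.filter_cons_of_pos (by simpa using hx)]
        exact .touch x ht hx
      · rw [List.filter_cons_of_neg (by simpa using hx)]
        refine .none hw ?_
        rintro b (hb | hb | hb)
        · simp [h.next_none_of_touch ht] at hb
        · simp [hw] at hb
        · rw [ht] at hb
          cases hb
          exact hx
    | none =>
      cases hb : G.next v with
      | none =>
        simp only [Option.toList_none, List.append_nil, List.filter_nil]
        refine .none hw ?_
        rintro b (h' | h' | h') <;> simp_all
      | some b =>
        simp only [Option.toList_some, Option.toList_none, List.append_nil, List.nil_append]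
        by_cases hx : ∀ a, G.Edge a b → s.Executed a
        · rw [List.filter_cons_of_pos (by simpa using hx)]
          exact .next b hw hb hx
        · rw [List.filter_cons_of_neg (by simpa using hx)]
          refine .none hw ?_
          rintro b' (h' | h' | h')
          · rw [hb] at h'
            cases h'
            exact hx
          · simp [hw] at h'
          · simp [ht] at h'

/-- The possible outcomes of an action of `p`, with victim `r`. -/
inductive StepCase (G : FutureGraph V) (s : WSState V P) (p r : Fin P) : WSState V P → Prop
  | exec (v : V) (c : List V) : s.current p = some v → Enabled G (s.execute p v c) v c →
      StepCase G s p r (s.execute p v c)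
  | pop (a : V) (d : List V) : s.current p = none → s.deque p = a :: d →
      StepCase G s p r (s.pop p a d)
  | steal (a : V) (l : List V) : s.current p = none → s.deque p = [] → s.deque r = l ++ [a] →
      r ≠ p → StepCase G s p r (s.steal p r a)
  | fail : s.current p = none → s.deque p = [] → s.deque r = [] → StepCase G s p r s

theorem Enabled.congr {s s' : WSState V P} {v : V} {c : List V} (hs : s.history = s'.history)
    (hc : Enabled G s v c) : Enabled G s' v c := by
  have key : ∀ b, s.Ready G b ↔ s'.Ready G b := by
    intro b
    simp only [Ready, Executed, hs]
  cases hc with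
  | fork w r h1 h2 => exact .fork w r h1 h2
  | next b h1 h2 h3 => exact .next b h1 h2 ((key b).1 h3)
  | touch x h1 h2 => exact .touch x h1 ((key x).1 h2)
  | none h1 h2 => exact .none h1 fun b hb hr => h2 b hb ((key b).2 hr)

theorem stepCase_step [Finite V] (h : G.IsStructuredSingleTouch) (s : WSState V P) (p r : Fin P) :
    StepCase G s p r (s.step G p r) := by
  unfold step
  split
  · rename_i v hv
    refine StepCase.exec v _ hv ?_
    refine Enabled.congr ?_ (enabled_readyChildren h ⟨p, ?_⟩)
    · rfl
    · simp
  · rename_i hv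
    split
    · rename_i a d hd
      exact StepCase.pop a d hv hd
    · rename_i hd
      split
      · rename_i a ha
        obtain ⟨l, hl⟩ := List.getLast?_eq_some_iff.1 ha
        refine StepCase.steal a l hv hd hl ?_
        rintro rfl
        simp [hd] at hl
      · rename_i ha
        exact StepCase.fail hv hd (List.getLast?_eq_none_iff.1 ha)

/-! ### The basic invariants -/

/-- The invariants of an execution. The nodes at hand of a processor, from the one that is about to
be executed to the top of the deque, are nested: each lies in the future thread of the fork whose
right child is the next one. -/
structure Inv (G : FutureGraph V) (s : WSState V P) : Prop where
  nodup : ∀ p, (s.history p ++ s.pending p).Nodup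
  disj : ∀ p q v, v ∈ s.history p ++ s.pending p → v ∈ s.history q ++ s.pending q → p = q
  closed : ∀ a b, G.Edge a b → s.Executed b → s.Executed a
  ready : ∀ p v, v ∈ s.pending p → s.Ready G v
  complete : ∀ v, ¬ s.Executed v → s.Ready G v → ∃ p, v ∈ s.pending p
  stack : ∀ p, (s.pending p).IsChain (fun a b => G.Under b a)
  right : ∀ p, ∀ v ∈ s.deque p, G.IsRight v

theorem Inv.not_executed {s : WSState V P} (hs : s.Inv G) {p : Fin P} {v : V}
    (hv : v ∈ s.pending p) : ¬ s.Executed v := by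
  rintro ⟨q, hq⟩
  have := hs.disj p q v (by simp [hv]) (by simp [hq])
  subst this
  exact List.disjoint_of_nodup_append (hs.nodup p) hq hv

theorem Inv.executed_of_reach {s : WSState V P} (hs : s.Inv G) {a b : V} (hab : G.Reach a b)
    (hb : s.Executed b) : s.Executed a := by
  induction hab with
  | refl => exact hb
  | tail _ h ih => exact ih (hs.closed _ _ h hb)

theorem inv_init (h : G.IsStructuredSingleTouch) (p₀ : Fin P) : (init G p₀).Inv G := by
  have hp : ∀ p, (init G p₀).pending p = if p = p₀ then [G.root] else [] := by
    intro p
    simp only [pending, init, List.append_nil]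
    split
    · subst p; simp
    · rename_i hne; simp [Function.update_of_ne hne]
  have hh : ∀ p, (init G p₀).history p = [] := fun p => rfl
  have he : ∀ b, ¬ (init G p₀).Executed b := by
    rintro b ⟨p, hb⟩
    simp [hh] at hb
  constructor
  · intro p
    rw [hh, hp]
    split <;> simp
  · intro p q v
    rw [hh, hh, hp, hp]
    split <;> split <;> simp_all
  · intro a b _ hb
    exact absurd hb (he b)
  · intro p v hv a ha
    rw [hp] at hv
    split at hv
    · simp at hv
      subst hv
      exact absurd ha (h.root_in a)
    · simp at hv
  · intro v _ hr
    by_cases hv : v = G.root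
    · exact ⟨p₀, by rw [hp]; simp [hv]⟩
    · exfalso
      rcases h.thread_start v hv with ⟨u, hu⟩ | ⟨u, hu⟩
      · exact he u (hr u (Or.inl hu))
      · exact he u (hr u (Or.inr (Or.inl hu)))
  · intro p
    rw [hp]
    split <;> simp
  · intro p v hv
    simp [init] at hv

theorem pending_execute_self (s : WSState V P) (p : Fin P) (v : V) (c : List V) :
    (s.execute p v c).pending p = c ++ s.deque p := by
  cases c <;> simp [pending, execute]

theorem pending_execute_of_ne (s : WSState V P) {p q : Fin P} (v : V) (c : List V) (hq : q ≠ p) :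
    (s.execute p v c).pending q = s.pending q := by
  simp [pending, execute, Function.update_of_ne hq]

theorem history_execute_self (s : WSState V P) (p : Fin P) (v : V) (c : List V) :
    (s.execute p v c).history p = s.history p ++ [v] := by
  simp [execute]

theorem history_execute_of_ne (s : WSState V P) {p q : Fin P} (v : V) (c : List V) (hq : q ≠ p) :
    (s.execute p v c).history q = s.history q := by
  simp [execute, Function.update_of_ne hq]

theorem pending_pop {s : WSState V P} {p : Fin P} {a : V} {d : List V} (hc : s.current p = none)
    (hd : s.deque p = a :: d) (q : Fin P) : (s.pop p a d).pending q = s.pending q := by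
  by_cases hq : q = p
  · subst hq
    simp [pending, pop, hc, hd]
  · simp [pending, pop, Function.update_of_ne hq]

theorem pending_steal_self {s : WSState V P} {p r : Fin P} {a : V} (hd : s.deque p = [])
    (hr : r ≠ p) : (s.steal p r a).pending p = [a] := by
  simp [pending, steal, Function.update_of_ne hr.symm, hd]

theorem pending_steal_victim {s : WSState V P} {p r : Fin P} {a : V} {l : List V}
    (hl : s.deque r = l ++ [a]) (hr : r ≠ p) :
    (s.steal p r a).pending r ++ [a] = s.pending r := by
  simp [pending, steal, Function.update_of_ne hr, hl]

theorem pending_steal_of_ne (s : WSState V P) {p q r : Fin P} (a : V) (hq : q ≠ p) (hr : q ≠ r) :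
    (s.steal p r a).pending q = s.pending q := by
  simp [pending, steal, Function.update_of_ne hr, Function.update_of_ne hq]

theorem Enabled.edge {s : WSState V P} {v : V} {c : List V} (hc : Enabled G s v c) {b : V}
    (hb : b ∈ c) : G.Edge v b := by
  cases hc with
  | fork w r h1 h2 =>
    simp at hb
    rcases hb with rfl | rfl
    · exact Or.inr (Or.inl h1)
    · exact Or.inl h2
  | next b' h1 h2 h3 =>
    simp at hb
    subst hb
    exact Or.inl h2
  | touch x h1 h2 =>
    simp at hb
    subst hb
    exact Or.inr (Or.inr h1)
  | none h1 h2 => simp at hb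

theorem Enabled.ready (h : G.IsStructuredSingleTouch) {s : WSState V P} {v : V} {c : List V}
    (hv : s.Executed v) (hc : Enabled G s v c) {b : V} (hb : b ∈ c) : s.Ready G b := by
  cases hc with
  | fork w r h1 h2 =>
    simp at hb
    rcases hb with rfl | rfl
    · rintro a (ha | ha | ha)
      · exact absurd ha (h.fork_left v b h1 a).1
      · rwa [h.future_inj _ _ _ ha h1]
      · exact absurd ha (h.fork_left v b h1 a).2
    · rintro a (ha | ha | ha)
      · rwa [h.next_inj _ _ _ ha h2]
      · exact absurd h2 (h.fork_left a b ha v).1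
      · exact absurd ha (h.fork_right v w b h1 h2 a)
  | next b' h1 h2 h3 =>
    simp at hb
    exact hb ▸ h3
  | touch x h1 h2 =>
    simp at hb
    exact hb ▸ h2
  | none h1 h2 => simp at hb

theorem Enabled.mem_of_ready [Finite V] (h : G.IsStructuredSingleTouch) {s : WSState V P} {v : V}
    {c : List V} (hc : Enabled G s v c) {b : V} (hb : G.Edge v b) (hr : s.Ready G b) : b ∈ c := by
  cases hc with
  | fork w r h1 h2 =>
    rcases hb with hb | hb | hb
    · simp_all
    · simp_all
    · simp [h.touch_none_of_next h2] at hb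
  | next b' h1 h2 h3 =>
    rcases hb with hb | hb | hb
    · simp_all
    · simp_all
    · simp [h.touch_none_of_next h2] at hb
  | touch x h1 h2 =>
    rcases hb with hb | hb | hb
    · simp [h.next_none_of_touch h1] at hb
    · simp [h.future_none_of_touch h1] at hb
    · simp_all
  | none h1 h2 => exact absurd hr (h2 b hb)

theorem Enabled.nodup (h : G.IsStructuredSingleTouch) {s : WSState V P} {v : V}
    {c : List V} (hc : Enabled G s v c) : c.Nodup := by
  cases hc with
  | fork w r h1 h2 =>
    have : w ≠ r := by
      rintro rfl
      exact (h.fork_left v w h1 v).1 h2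
    simp [this]
  | next b' h1 h2 h3 => simp
  | touch x h1 h2 => simp
  | none h1 h2 => simp

theorem mem_pending_of_current {s : WSState V P} {p : Fin P} {v : V} (hv : s.current p = some v) :
    v ∈ s.pending p := by simp [pending, hv]

theorem mem_pending_of_deque {s : WSState V P} {p : Fin P} {v : V} (hv : v ∈ s.deque p) :
    v ∈ s.pending p := by simp [pending, hv]

/-- A child enabled by the execution of `v` is new. -/
theorem Inv.enabled_fresh {s : WSState V P} (hs : s.Inv G)
    {p : Fin P} {v : V} (hv : s.current p = some v) {b : V} (hb : G.Edge v b) (q : Fin P) :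
    b ∉ s.history q ++ s.pending q := by
  have hnv := hs.not_executed (mem_pending_of_current hv)
  intro hq
  rcases List.mem_append.1 hq with hq | hq
  · exact hnv (hs.closed v b hb ⟨q, hq⟩)
  · exact hnv (hs.ready q b hq v hb)

theorem Inv.execute [Finite V] (h : G.IsStructuredSingleTouch) {s : WSState V P} (hs : s.Inv G)
    {p : Fin P} {v : V} (hv : s.current p = some v) {c : List V}
    (hc : Enabled G (s.execute p v c) v c) : (s.execute p v c).Inv G := by
  have hpv : s.pending p = v :: s.deque p := by simp [pending, hv]
  have hfresh := fun b hb => hs.enabled_fresh hv (hc.edge (b := b) hb)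
  have hL : ∀ q b, b ∈ (s.execute p v c).history q ++ (s.execute p v c).pending q ↔
      b ∈ s.history q ++ s.pending q ∨ (q = p ∧ b ∈ c) := by
    intro q b
    by_cases hq : q = p
    · subst hq
      rw [history_execute_self, pending_execute_self, hpv]
      simp
      tauto
    · rw [history_execute_of_ne _ _ _ hq, pending_execute_of_ne _ _ _ hq]
      simp [hq]
  have hpend : ∀ q b, b ∈ (s.execute p v c).pending q → b ∈ s.pending q ∨ (q = p ∧ b ∈ c) := by
    intro q b hb
    by_cases hq : q = p
    · subst hq
      rw [pending_execute_self] at hb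
      rw [hpv]
      simp at hb ⊢
      tauto
    · rw [pending_execute_of_ne _ _ _ hq] at hb
      exact Or.inl hb
  have hexe : (s.execute p v c).Executed v := executed_execute.2 (Or.inr rfl)
  constructor
  · intro q
    by_cases hq : q = p
    · subst hq
      rw [history_execute_self, pending_execute_self]
      have h1 := hs.nodup q
      rw [hpv] at h1
      have h2 : (c ++ (s.history q ++ v :: s.deque q)).Nodup := by
        rw [List.nodup_append']
        refine ⟨hc.nodup h, h1, ?_⟩
        intro b hb hb'
        exact hfresh b hb q (by rw [hpv]; exact hb')
      refine (List.Perm.nodup_iff ?_).1 h2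
      rw [List.append_assoc, List.singleton_append]
      refine (List.perm_append_comm_assoc _ _ _).trans (List.Perm.append_left _ ?_)
      exact List.perm_middle
    · rw [history_execute_of_ne _ _ _ hq, pending_execute_of_ne _ _ _ hq]
      exact hs.nodup q
  · intro q q' b hb hb'
    rw [hL] at hb hb'
    rcases hb with hb | ⟨rfl, hb⟩
    · rcases hb' with hb' | ⟨rfl, hb'⟩
      · exact hs.disj _ _ _ hb hb'
      · exact absurd hb (hfresh b hb' q)
    · rcases hb' with hb' | ⟨rfl, hb'⟩
      · exact absurd hb' (hfresh b hb q')
      · rfl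
  · intro a b hab hb
    rw [executed_execute] at hb ⊢
    left
    rcases hb with hb | rfl
    · exact hs.closed a b hab hb
    · exact hs.ready p b (mem_pending_of_current hv) a hab
  · intro q b hb
    rcases hpend q b hb with hb | ⟨-, hb⟩
    · intro a ha
      exact executed_execute.2 (Or.inl (hs.ready q b hb a ha))
    · exact hc.ready h hexe hb
  · intro b hb hr
    have hbv : b ≠ v := fun e => hb (executed_execute.2 (Or.inr e))
    by_cases hvb : G.Edge v b
    · refine ⟨p, ?_⟩
      rw [pending_execute_self]
      exact List.mem_append_left _ (hc.mem_of_ready h hvb hr)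
    · obtain ⟨q, hq⟩ := hs.complete b (fun h' => hb (executed_execute.2 (Or.inl h'))) (by
        intro a ha
        rcases executed_execute.1 (hr a ha) with h' | rfl
        · exact h'
        · exact absurd ha hvb)
      refine ⟨q, ?_⟩
      by_cases hqp : q = p
      · subst hqp
        rw [hpv] at hq
        rw [pending_execute_self]
        simp [hbv] at hq
        simp [hq]
      · rwa [pending_execute_of_ne _ _ _ hqp]
  · intro q
    by_cases hqp : q = p
    swap
    · rw [pending_execute_of_ne _ _ _ hqp]
      exact hs.stack q
    subst hqp
    rw [pending_execute_self]
    have hst := hs.stack q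
    rw [hpv] at hst
    cases hc with
    | fork w r h1 h2 =>
      simp only [List.cons_append, List.nil_append, List.isChain_cons_cons]
      refine ⟨⟨v, h2, w, h1, Relation.ReflTransGen.refl⟩, ?_⟩
      cases hd : s.deque q with
      | nil => simp
      | cons b d =>
        rw [hd, List.isChain_cons_cons] at hst
        rw [List.isChain_cons_cons]
        exact ⟨hst.1.step h2, hst.2⟩
    | next b h1 h2 h3 =>
      cases hd : s.deque q with
      | nil => simp
      | cons b d =>
        rw [hd, List.isChain_cons_cons] at hst
        rw [List.singleton_append, List.isChain_cons_cons]
        exact ⟨hst.1.step h2, hst.2⟩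
    | touch x h1 h2 =>
      -- the right child at the bottom of the deque reaches the local parent of `x`
      cases hd : s.deque q with
      | nil => simp
      | cons b d =>
        exfalso
        rw [hd, List.isChain_cons_cons] at hst
        obtain ⟨u, hub, hs'⟩ := hst.1
        obtain ⟨y, hy⟩ := h.exists_local_parent h1
        have hyv : y ≠ v := by
          rintro rfl
          simp [h.touch_none_of_next hy] at h1
        have hey : s.Executed y := by
          rcases executed_execute.1 (h2 y (Or.inl hy)) with h' | h'
          · exact h'
          · exact absurd h' hyv
        have hbq : b ∈ s.pending q := mem_pending_of_deque (by simp [hd])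
        exact hs.not_executed hbq
          (hs.executed_of_reach (h.reach_local_parent hs' h1 hy hub) hey)
    | none h1 h2 =>
      exact hst.tail
  · intro q b hb
    by_cases hqp : q = p
    · subst hqp
      simp only [WSState.execute, Function.update_self, List.mem_append] at hb
      rcases hb with hb | hb
      · cases hc with
        | fork w r h1 h2 =>
          simp at hb
          subst hb
          exact ⟨v, w, h1, h2⟩
        | next b h1 h2 h3 => simp at hb
        | touch x h1 h2 => simp at hb
        | none h1 h2 => simp at hb
      · exact hs.right q b hb
    · simp only [WSState.execute, Function.update_of_ne hqp] at hb
      exact hs.right q b hb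

theorem Inv.pop {s : WSState V P} (hs : s.Inv G)
    {p : Fin P} {a : V} {d : List V} (hc : s.current p = none) (hd : s.deque p = a :: d) :
    (s.pop p a d).Inv G := by
  have hp := pending_pop hc hd
  have hh : (s.pop p a d).history = s.history := rfl
  constructor
  · intro q
    rw [hp, hh]
    exact hs.nodup q
  · intro q q' b
    rw [hp, hp, hh]
    exact hs.disj q q' b
  · exact hs.closed
  · intro q b hb
    rw [hp] at hb
    exact hs.ready q b hb
  · intro b hb hr
    obtain ⟨q, hq⟩ := hs.complete b hb hr
    exact ⟨q, by rwa [hp]⟩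
  · intro q
    rw [hp]
    exact hs.stack q
  · intro q b hb
    by_cases hqp : q = p
    · subst hqp
      simp only [WSState.pop, Function.update_self] at hb
      exact hs.right q b (by simp [hd, hb])
    · simp only [WSState.pop, Function.update_of_ne hqp] at hb
      exact hs.right q b hb

theorem Inv.steal {s : WSState V P} (hs : s.Inv G)
    {p r : Fin P} {a : V} {l : List V} (hc : s.current p = none) (hd : s.deque p = [])
    (hl : s.deque r = l ++ [a]) (hr : r ≠ p) : (s.steal p r a).Inv G := by
  have hh : (s.steal p r a).history = s.history := rfl
  have hp := pending_steal_self (a := a) hd hr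
  have hv := pending_steal_victim hl hr
  have hq := fun q => pending_steal_of_ne (q := q) (p := p) (r := r) s a
  have hp0 : s.pending p = [] := by simp [pending, hc, hd]
  have har : a ∈ s.pending r := by rw [← hv]; simp
  have hmem : ∀ q b, b ∈ (s.steal p r a).pending q →
      (q = p ∧ b = a) ∨ (q ≠ p ∧ b ∈ s.pending q ∧ (b = a → q ≠ r)) := by
    intro q b hb
    by_cases hqp : q = p
    · subst hqp
      rw [hp] at hb
      left
      simpa using hb
    right
    refine ⟨hqp, ?_⟩
    by_cases hqr : q = r
    · subst hqr
      have hn := hs.nodup q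
      rw [← hv, ← List.append_assoc, List.nodup_append'] at hn
      refine ⟨by rw [← hv]; exact List.mem_append_left _ hb, ?_⟩
      rintro rfl
      exact absurd (List.mem_singleton_self b) (hn.2.2 (List.mem_append_right _ hb))
    · rw [hq q hqp hqr] at hb
      exact ⟨hb, fun _ => hqr⟩
  constructor
  · intro q
    rw [hh]
    by_cases hqp : q = p
    · subst hqp
      rw [hp, List.nodup_append']
      refine ⟨(List.nodup_append.1 (hs.nodup q)).1, by simp, ?_⟩
      intro b hb hb'
      simp at hb'
      subst hb'
      exact hs.not_executed har ⟨q, hb⟩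
    by_cases hqr : q = r
    · subst hqr
      have hn := hs.nodup q
      rw [← hv, ← List.append_assoc, List.nodup_append'] at hn
      exact hn.1
    · rw [hq q hqp hqr]
      exact hs.nodup q
  · have key : ∀ q b, b ∈ s.history q ++ (s.steal p r a).pending q →
        (q = p ∧ b = a) ∨ (b ∈ s.history q ++ s.pending q ∧ b ≠ a) := by
      intro q b hb
      rcases List.mem_append.1 hb with hb1 | hb
      · right
        refine ⟨List.mem_append_left _ hb1, ?_⟩
        rintro rfl
        exact hs.not_executed har ⟨q, hb1⟩
      · rcases hmem q b hb with h1 | ⟨h1, h2, h3⟩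
        · exact Or.inl h1
        · right
          refine ⟨List.mem_append_right _ h2, fun hba => h3 hba ?_⟩
          exact hs.disj q r a (List.mem_append_right _ (hba ▸ h2)) (List.mem_append_right _ har)
    intro q q' b hb hb'
    rw [hh] at hb hb'
    rcases key q b hb with ⟨h1, h2⟩ | ⟨h1, h2⟩ <;> rcases key q' b hb' with ⟨h3, h4⟩ | ⟨h3, h4⟩
    · rw [h1, h3]
    · exact absurd h2 h4
    · exact absurd h4 h2
    · exact hs.disj q q' b h1 h3
  · exact hs.closed
  · intro q b hb
    rcases hmem q b hb with ⟨-, rfl⟩ | ⟨-, h1, -⟩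
    · exact hs.ready r b har
    · exact hs.ready q b h1
  · intro b hb hr'
    obtain ⟨q, hqb⟩ := hs.complete b hb hr'
    by_cases hqp : q = p
    · subst hqp
      simp [hp0] at hqb
    by_cases hqr : q = r
    · subst hqr
      rw [← hv] at hqb
      rcases List.mem_append.1 hqb with h1 | h1
      · exact ⟨q, h1⟩
      · exact ⟨p, by rw [hp]; exact h1⟩
    · exact ⟨q, by rwa [hq q hqp hqr]⟩
  · intro q
    by_cases hqp : q = p
    · subst hqp
      simp [hp]
    by_cases hqr : q = r
    · subst hqr
      have := hs.stack q
      rw [← hv] at this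
      exact (List.isChain_append.1 this).1
    · rw [hq q hqp hqr]
      exact hs.stack q
  · intro q b hb
    by_cases hqr : q = r
    · subst hqr
      simp only [WSState.steal, Function.update_self] at hb
      exact hs.right q b (List.dropLast_subset _ hb)
    · simp only [WSState.steal, Function.update_of_ne hqr] at hb
      exact hs.right q b hb

theorem Inv.step [Finite V] (h : G.IsStructuredSingleTouch) {s : WSState V P} (hs : s.Inv G)
    (p r : Fin P) : (s.step G p r).Inv G := by
  have hstep := stepCase_step h s p r
  generalize s.step G p r = s' at hstep ⊢
  cases hstep with
  | exec v c h1 h2 => exact hs.execute h h1 h2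
  | pop a d h1 h2 => exact hs.pop h1 h2
  | steal a l h1 h2 h3 h4 => exact hs.steal h1 h2 h3 h4
  | fail h1 h2 h3 => exact hs

end WSState

/-! ### Deviations and their causes -/

namespace FutureGraph

variable {V : Type u} {G : FutureGraph V}

/-- In the sequential execution `b` is executed immediately after `a`: it is the left child of the
fork `a`, or the successor of `a` in its thread, or `a` is the last node of a future thread and `b`
is the right child of the fork of this thread. -/
def SeqStep (G : FutureGraph V) (a b : V) : Prop :=
  G.future a = some b ∨ (G.future a = none ∧ G.next a = some b) ∨ (G.Under b a ∧ G.touch a ≠ none)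

/-- Let `St` be the set of the nodes that have been stolen, and `Lt` the set of the forks whose
future thread has been late: the local parent of its touch was executed before its last node. The
fork `v` is disturbed if its right child has been stolen, or if its future thread contains the touch
of the future thread of a fork in `Lt`. -/
def Disturbed (G : FutureGraph V) (St Lt : Set V) (v : V) : Prop :=
  (∃ w r, G.future v = some w ∧ G.next v = some r ∧ r ∈ St) ∨
    ∃ d ∈ Lt, ∃ z x, G.Spawned d z ∧ G.touch z = some x ∧ G.Spawned v x

/-- The nodes that may fail to be executed immediately after their predecessor in the sequential
execution: the touches of the future threads of forks in `Lt`, and the right children of disturbed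
forks. -/
def Exceptional (G : FutureGraph V) (St Lt : Set V) (b : V) : Prop :=
  (∃ d ∈ Lt, ∃ z, G.Spawned d z ∧ G.touch z = some b) ∨
    ∃ v w, G.future v = some w ∧ G.next v = some b ∧ G.Disturbed St Lt v

theorem Disturbed.mono {St St' Lt Lt' : Set V} (hS : St ⊆ St') (hL : Lt ⊆ Lt') {v : V}
    (h : G.Disturbed St Lt v) : G.Disturbed St' Lt' v := by
  rcases h with ⟨w, r, h1, h2, h3⟩ | ⟨d, h1, h2⟩
  · exact Or.inl ⟨w, r, h1, h2, hS h3⟩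
  · exact Or.inr ⟨d, hL h1, h2⟩

theorem Exceptional.mono {St St' Lt Lt' : Set V} (hS : St ⊆ St') (hL : Lt ⊆ Lt') {v : V}
    (h : G.Exceptional St Lt v) : G.Exceptional St' Lt' v := by
  rcases h with ⟨d, h1, h2⟩ | ⟨v, w, h1, h2, h3⟩
  · exact Or.inl ⟨d, hL h1, h2⟩
  · exact Or.inr ⟨v, w, h1, h2, h3.mono hS hL⟩

theorem SeqStep.exists_edge {a b : V} (hab : G.SeqStep a b) : ∃ c, G.Edge c b := by
  rcases hab with h | ⟨-, h⟩ | ⟨⟨v, h, -⟩, -⟩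
  · exact ⟨a, Or.inr (Or.inl h)⟩
  · exact ⟨a, Or.inl h⟩
  · exact ⟨v, Or.inl h⟩

/-- The sequential predecessor is unique. -/
theorem SeqStep.left_unique (h : G.IsStructuredSingleTouch) {a a' b : V} (hab : G.SeqStep a b)
    (hab' : G.SeqStep a' b) : a = a' := by
  have key : ∀ {a a' : V}, (G.future a = none ∧ G.next a = some b) →
      ¬ (G.Under b a' ∧ G.touch a' ≠ none) := by
    rintro a a' ⟨h1, h2⟩ ⟨⟨v, h3, w, h4, -⟩, -⟩
    rw [h.next_inj _ _ _ h2 h3, h4] at h1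
    exact absurd h1 (by simp)
  rcases hab with h1 | h1 | h1 <;> rcases hab' with h2 | h2 | h2
  · exact h.future_inj _ _ _ h1 h2
  · exact absurd h2.2 (h.fork_left a b h1 a').1
  · obtain ⟨⟨v, h3, -⟩, -⟩ := h2
    exact absurd h3 (h.fork_left a b h1 v).1
  · exact absurd h1.2 (h.fork_left a' b h2 a).1
  · exact h.next_inj _ _ _ h1.2 h2.2
  · exact absurd h2 (key h1)
  · obtain ⟨⟨v, h3, -⟩, -⟩ := h1
    exact absurd h3 (h.fork_left a' b h2 v).1
  · exact absurd h1 (key h2)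
  · obtain ⟨⟨v, h3, hs⟩, h4⟩ := h1
    obtain ⟨⟨v', h3', hs'⟩, h4'⟩ := h2
    obtain rfl := h.next_inj _ _ _ h3 h3'
    obtain ⟨x, hx⟩ := Option.ne_none_iff_exists'.1 h4
    obtain ⟨x', hx'⟩ := Option.ne_none_iff_exists'.1 h4'
    exact h.touch_unique hs hs' hx hx'

end FutureGraph

namespace WSState

variable {V : Type u} {P : ℕ} {G : FutureGraph V}

/-- The local parent of the touch of the future thread of `d` has been executed, but the last node
of this thread has not. -/
def Late (G : FutureGraph V) (s : WSState V P) (d : V) : Prop :=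
  ∃ z x y, G.Spawned d z ∧ G.touch z = some x ∧ G.next y = some x ∧ s.Executed y ∧ ¬ s.Executed z

/-- The invariants that relate the order of execution to the sequential order. The sets `St` and
`Lt` collect the nodes that have been stolen, and the forks that have been late. -/
structure Trace (G : FutureGraph V) (s : WSState V P) (St Lt : Set V) : Prop where
  late_mem : ∀ d, s.Late G d → d ∈ Lt
  late_disturbed : ∀ d ∈ Lt, G.Disturbed St Lt d
  left_deque : ∀ v w r z x, G.future v = some w → G.next v = some r → G.Spawned v z →
    G.touch z = some x → s.Executed v → (∀ p, r ∉ s.deque p) → s.Executed z ∨ G.Disturbed St Lt v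
  last_executed : ∀ p r d, s.current p = none → s.deque p = r :: d →
    ∃ a, (s.history p).getLast? = some a ∧ G.Under r a ∧
      (G.touch a ≠ none ∨ ∃ d ∈ Lt, ∃ z x, G.Spawned d z ∧ G.touch z = some x ∧ G.next a = some x)
  current_step : ∀ p b, s.current p = some b → (s.history p = [] ∧ b = G.root) ∨
    (∃ a, (s.history p).getLast? = some a ∧ G.SeqStep a b) ∨ G.Exceptional St Lt b
  history_step : ∀ p l b r, s.history p = l ++ b :: r → (l = [] ∧ b = G.root) ∨
    (∃ a, l.getLast? = some a ∧ G.SeqStep a b) ∨ G.Exceptional St Lt b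

theorem trace_init (p₀ : Fin P) : (init G p₀).Trace G ∅ ∅ := by
  have he : ∀ b, ¬ (init G p₀).Executed b := by
    rintro b ⟨p, hb⟩
    simp [init] at hb
  constructor
  · rintro d ⟨z, x, y, -, -, -, hy, -⟩
    exact absurd hy (he y)
  · simp
  · intro v w r z x _ _ _ _ hv
    exact absurd hv (he v)
  · intro p r d _ hd
    simp [init] at hd
  · intro p b hb
    left
    refine ⟨rfl, ?_⟩
    by_cases hp : p = p₀
    · subst hp
      simpa [init] using hb.symm
    · simp [init, Function.update_of_ne hp] at hb
  · intro p l b r hb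
    simp [init] at hb

/-- If the local parent of the touch of the future thread of `d` has been executed, then so has the
right child of `d`, and it has left the deque. -/
theorem late_disturbed_of_left_deque [Finite V] (h : G.IsStructuredSingleTouch) {s : WSState V P}
    (hs : s.Inv G) {St Lt : Set V}
    (hleft : ∀ v w r z x, G.future v = some w → G.next v = some r → G.Spawned v z →
      G.touch z = some x → s.Executed v → (∀ p, r ∉ s.deque p) →
      s.Executed z ∨ G.Disturbed St Lt v) {d : V} (hd : s.Late G d) : G.Disturbed St Lt d := by
  obtain ⟨z, x, y, h1, h2, h3, h4, h5⟩ := hd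
  have h1' := h1
  obtain ⟨w, hw, hz⟩ := h1'
  obtain ⟨r, hr⟩ := h.next_of_future hw
  have her := hs.executed_of_reach (h.reach_local_parent h1 h2 h3 hr) h4
  refine (hleft d w r z x hw hr h1 h2 (hs.closed d r (Or.inl hr) her) ?_).resolve_left h5
  intro p hp
  exact hs.not_executed (mem_pending_of_deque hp) her

theorem Trace.execute [Finite V] (h : G.IsStructuredSingleTouch) {s : WSState V P}
    (hs : s.Inv G) {St Lt : Set V} (ht : s.Trace G St Lt) {p : Fin P} {v : V} {c : List V}
    (hv : s.current p = some v) (hc : Enabled G (s.execute p v c) v c) :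
    (s.execute p v c).Trace G St (Lt ∪ {d | (s.execute p v c).Late G d}) := by
  set s' := s.execute p v c with hs'def
  set Lt' := Lt ∪ {d | s'.Late G d} with hLt'
  have hs' : s'.Inv G := hs.execute h hv hc
  have hsub : Lt ⊆ Lt' := Set.subset_union_left
  have hnv := hs.not_executed (mem_pending_of_current hv)
  have hpv : s.pending p = v :: s.deque p := by simp [pending, hv]
  have hdq : ∀ q b, b ∈ s.deque q → b ∈ s'.deque q := by
    intro q b hb
    by_cases hqp : q = p
    · subst hqp
      simp [s', WSState.execute, hb]
    · simpa [s', WSState.execute, Function.update_of_ne hqp] using hb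
  have hleft : ∀ v w r z x, G.future v = some w → G.next v = some r → G.Spawned v z →
      G.touch z = some x → s'.Executed v → (∀ p, r ∉ s'.deque p) →
      s'.Executed z ∨ G.Disturbed St Lt' v := by
    intro u w r z x h1 h2 h3 h4 h5 h6
    rcases executed_execute.1 h5 with h5 | rfl
    · rcases ht.left_deque u w r z x h1 h2 h3 h4 h5 (fun q hq => h6 q (hdq q r hq)) with h7 | h7
      · exact Or.inl (executed_execute.2 (Or.inl h7))
      · exact Or.inr (h7.mono subset_rfl hsub)
    · exfalso
      apply h6 p
      cases hc with
      | fork w' r' h1' h2' =>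
        rw [h2] at h2'
        cases h2'
        simp [s', WSState.execute]
      | next b h1' h2' h3' => simp [h1] at h1'
      | touch b h1' h2' => simp [h.touch_none_of_next h2] at h1'
      | none h1' h2' => simp [h1] at h1'
  refine ⟨fun d hd => Or.inr hd, ?_, hleft, ?_, ?_, ?_⟩
  · rintro d (hd | hd)
    · exact (ht.late_disturbed d hd).mono subset_rfl hsub
    · exact late_disturbed_of_left_deque h hs' hleft hd
  · intro q r d hcur hdeq
    by_cases hqp : q = p
    swap
    · simp only [s', WSState.execute, Function.update_of_ne hqp] at hcur hdeq ⊢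
      obtain ⟨a, h1, h2, h3⟩ := ht.last_executed q r d hcur hdeq
      refine ⟨a, h1, h2, h3.imp_right ?_⟩
      rintro ⟨d, hd, h4⟩
      exact ⟨d, hsub hd, h4⟩
    subst hqp
    refine ⟨v, by simp [s', WSState.execute], ?_⟩
    simp only [s', WSState.execute, Function.update_self] at hcur hdeq
    cases hc with
    | fork w r h1 h2 => simp at hcur
    | next b h1 h2 h3 => simp at hcur
    | touch x h1 h2 => simp at hcur
    | none h1 h2 =>
      simp only [List.tail_nil, List.nil_append] at hdeq
      have hst := hs.stack q
      rw [hpv, hdeq, List.isChain_cons_cons] at hst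
      refine ⟨hst.1, ?_⟩
      cases hn : G.next v with
      | none =>
        left
        obtain ⟨u, -, hu⟩ := hst.1
        obtain ⟨-, x, hx⟩ := h.thread_end v (h.ne_final_of_spawned hu) hn
        simp [hx]
      | some b =>
        right
        have hnr := h2 b (Or.inl hn)
        simp only [Ready, not_forall] at hnr
        obtain ⟨z, hz, hze⟩ := hnr
        have hev : s'.Executed v := executed_execute.2 (Or.inr rfl)
        rcases hz with hz | hz | hz
        · rw [h.next_inj _ _ _ hz hn] at hze
          exact absurd hev hze
        · exact absurd hn (h.fork_left z b hz v).1
        · obtain ⟨d, hd⟩ := h.exists_spawned_of_touch hz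
          exact ⟨d, Or.inr ⟨z, b, v, hd, hz, hn, hev, hze⟩, z, b, hd, hz, rfl⟩
  · intro q b hb
    by_cases hqp : q = p
    swap
    · simp only [s', WSState.execute, Function.update_of_ne hqp] at hb ⊢
      exact (ht.current_step q b hb).imp_right (Or.imp_right fun h => h.mono subset_rfl hsub)
    subst hqp
    right
    simp only [s', WSState.execute, Function.update_self] at hb ⊢
    have hlast : (s.history q ++ [v]).getLast? = some v := by simp
    cases hc with
    | fork w r h1 h2 =>
      simp at hb
      subst hb
      exact Or.inl ⟨v, hlast, Or.inl h1⟩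
    | next b' h1 h2 h3 =>
      simp at hb
      subst hb
      exact Or.inl ⟨v, hlast, Or.inr (Or.inl ⟨h1, h2⟩)⟩
    | touch x h1 h2 =>
      -- a touch that is enabled by the last node of the future thread: the thread was late
      simp at hb
      subst hb
      right
      obtain ⟨y, hy⟩ := h.exists_local_parent h1
      have hyv : y ≠ v := by
        rintro rfl
        simp [h.touch_none_of_next hy] at h1
      have hey : s.Executed y := (executed_execute.1 (h2 y (Or.inl hy))).resolve_right hyv
      obtain ⟨d, hd⟩ := h.exists_spawned_of_touch h1
      exact Or.inl ⟨d, hsub (ht.late_mem d ⟨v, x, y, hd, h1, hy, hey, hnv⟩), v, hd, h1⟩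
    | none h1 h2 => simp at hb
  · intro q l b r hl
    by_cases hqp : q = p
    swap
    · simp only [s', WSState.execute, Function.update_of_ne hqp] at hl
      exact (ht.history_step q l b r hl).imp_right (Or.imp_right fun h => h.mono subset_rfl hsub)
    subst hqp
    simp only [s', WSState.execute, Function.update_self] at hl
    rcases List.eq_nil_or_concat r with rfl | ⟨r', b', rfl⟩
    · obtain ⟨rfl, e⟩ := List.append_inj' hl rfl
      cases e
      exact (ht.current_step q v hv).imp_right (Or.imp_right fun h => h.mono subset_rfl hsub)
    · rw [List.concat_eq_append, ← List.cons_append, ← List.append_assoc] at hl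
      obtain ⟨e, -⟩ := List.append_inj' hl rfl
      exact (ht.history_step q l b r' e).imp_right (Or.imp_right fun h => h.mono subset_rfl hsub)

theorem Trace.pop {s : WSState V P} (h : G.IsStructuredSingleTouch) (hs : s.Inv G)
    {St Lt : Set V} (ht : s.Trace G St Lt) {p : Fin P} {a : V} {d : List V}
    (hc : s.current p = none) (hd : s.deque p = a :: d) : (s.pop p a d).Trace G St Lt := by
  obtain ⟨e, he1, he2, he3⟩ := ht.last_executed p a d hc hd
  obtain ⟨u, hu, hue⟩ := he2
  refine ⟨ht.late_mem, ht.late_disturbed, ?_, ?_, ?_, ht.history_step⟩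
  · intro v w r z x h1 h2 h3 h4 h5 h6
    rw [executed_pop]
    by_cases hr : r = a
    · subst hr
      obtain rfl := h.next_inj _ _ _ h2 hu
      rcases he3 with he3 | ⟨d', h7, z', x', h8, h9, h10⟩
      · left
        obtain ⟨x', hx'⟩ := Option.ne_none_iff_exists'.1 he3
        rw [← h.touch_unique hue h3 hx' h4]
        exact ⟨p, List.mem_of_getLast? he1⟩
      · exact Or.inr (Or.inr ⟨d', h7, z', x', h8, h9, hue.step h10⟩)
    · refine ht.left_deque v w r z x h1 h2 h3 h4 h5 fun q hq => h6 q ?_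
      by_cases hqp : q = p
      · subst hqp
        simpa [WSState.pop, hd, hr] using hq
      · simpa [WSState.pop, Function.update_of_ne hqp] using hq
  · intro q r d' hcur hdeq
    by_cases hqp : q = p
    · subst hqp
      simp [WSState.pop] at hcur
    · simp only [WSState.pop, Function.update_of_ne hqp] at hcur hdeq ⊢
      exact ht.last_executed q r d' hcur hdeq
  · intro q b hb
    by_cases hqp : q = p
    swap
    · simp only [WSState.pop, Function.update_of_ne hqp] at hb ⊢
      exact ht.current_step q b hb
    subst hqp
    simp only [WSState.pop, Function.update_self, Option.some.injEq] at hb ⊢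
    subst hb
    right
    rcases he3 with he3 | ⟨d', h7, z', x', h8, h9, h10⟩
    · exact Or.inl ⟨e, he1, Or.inr (Or.inr ⟨⟨u, hu, hue⟩, he3⟩)⟩
    · obtain ⟨v, w, hv, hva⟩ := hs.right q a (by simp [hd])
      obtain rfl := h.next_inj _ _ _ hu hva
      exact Or.inr (Or.inr ⟨u, w, hv, hu, Or.inr ⟨d', h7, z', x', h8, h9, hue.step h10⟩⟩)

theorem Trace.steal {s : WSState V P} (hs : s.Inv G)
    {St Lt : Set V} (ht : s.Trace G St Lt) {p r : Fin P} {a : V} {l : List V}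
    (hd : s.deque p = []) (hl : s.deque r = l ++ [a])
    (hr : r ≠ p) : (s.steal p r a).Trace G (insert a St) Lt := by
  have hsub : St ⊆ insert a St := Set.subset_insert a St
  have hdis : ∀ {v}, G.Disturbed St Lt v → G.Disturbed (insert a St) Lt v :=
    fun h => h.mono hsub subset_rfl
  have hexc : ∀ {v}, G.Exceptional St Lt v → G.Exceptional (insert a St) Lt v :=
    fun h => h.mono hsub subset_rfl
  refine ⟨ht.late_mem, fun d hd => hdis (ht.late_disturbed d hd), ?_, ?_, ?_,
    fun q l' b r' hb => (ht.history_step q l' b r' hb).imp_right (Or.imp_right hexc)⟩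
  · intro v w r' z x h1 h2 h3 h4 h5 h6
    rw [executed_steal]
    by_cases hra : r' = a
    · subst hra
      exact Or.inr (Or.inl ⟨w, r', h1, h2, Set.mem_insert _ _⟩)
    · refine (ht.left_deque v w r' z x h1 h2 h3 h4 h5 fun q hq => h6 q ?_).imp_right hdis
      by_cases hqr : q = r
      · subst hqr
        simpa [WSState.steal, hl, hra] using hq
      · simpa [WSState.steal, Function.update_of_ne hqr] using hq
  · intro q r' d' hcur hdeq
    by_cases hqp : q = p
    · subst hqp
      simp [WSState.steal] at hcur
    simp only [WSState.steal, Function.update_of_ne hqp] at hcur hdeq ⊢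
    by_cases hqr : q = r
    · subst hqr
      rw [Function.update_self, hl, List.dropLast_concat] at hdeq
      exact ht.last_executed q r' (d' ++ [a]) hcur (by rw [hl, hdeq]; rfl)
    · rw [Function.update_of_ne hqr] at hdeq
      exact ht.last_executed q r' d' hcur hdeq
  · intro q b hb
    by_cases hqp : q = p
    · subst hqp
      simp only [WSState.steal, Function.update_self, Option.some.injEq] at hb
      subst hb
      obtain ⟨v, w, hv, hva⟩ := hs.right r a (by simp [hl])
      exact Or.inr (Or.inr (Or.inr ⟨v, w, hv, hva, Or.inl ⟨w, a, hv, hva, Set.mem_insert _ _⟩⟩))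
    · simp only [WSState.steal, Function.update_of_ne hqp] at hb ⊢
      exact (ht.current_step q b hb).imp_right (Or.imp_right hexc)

/-- The nodes that are stolen by an action of `p` with victim `r`: one node or none. -/
def stolenBy (s : WSState V P) (p r : Fin P) : Set V :=
  {a | s.current p = none ∧ s.deque p = [] ∧ (s.deque r).getLast? = some a}

theorem Trace.step [Finite V] (h : G.IsStructuredSingleTouch) {s : WSState V P}
    (hs : s.Inv G) {St Lt : Set V} (ht : s.Trace G St Lt) (p r : Fin P) :
    (s.step G p r).Trace G (s.stolenBy p r ∪ St) (Lt ∪ {d | (s.step G p r).Late G d}) := by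
  have hstep := stepCase_step h s p r
  have hlate : ∀ s' : WSState V P, s'.Trace G (s.stolenBy p r ∪ St) Lt →
      s'.Trace G (s.stolenBy p r ∪ St) (Lt ∪ {d | s'.Late G d}) := by
    intro s' hs'
    have : Lt ∪ {d | s'.Late G d} = Lt := Set.union_eq_self_of_subset_right hs'.late_mem
    rwa [this]
  generalize s.step G p r = s' at hstep ⊢
  cases hstep with
  | exec v c h1 h2 =>
    have : s.stolenBy p r = ∅ := by
      ext a
      simp [stolenBy, h1]
    rw [this, Set.empty_union]
    exact ht.execute h hs h1 h2
  | pop a d h1 h2 =>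
    apply hlate
    have : s.stolenBy p r = ∅ := by
      ext a
      simp [stolenBy, h2]
    rw [this, Set.empty_union]
    exact ht.pop h hs h1 h2
  | steal a l h1 h2 h3 h4 =>
    apply hlate
    have : s.stolenBy p r = {a} := by
      ext b
      simp [stolenBy, h1, h2, h3, eq_comm]
    rw [this, Set.singleton_union]
    exact ht.steal hs h2 h3 h4
  | fail h1 h2 h3 =>
    apply hlate
    have : s.stolenBy p r = ∅ := by
      ext b
      simp [stolenBy, h3]
    rw [this, Set.empty_union]
    exact ht

end WSState

/-! ### Counting deviations -/

namespace FutureGraph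

variable {V : Type u} {G : FutureGraph V}

open Classical in
/-- The fork whose future thread contains the touch of the future thread of `d`; a junk value if
there is no such fork. -/
noncomputable def nextFork (G : FutureGraph V) (d : V) : V :=
  if h : ∃ v z x, G.Spawned d z ∧ G.touch z = some x ∧ G.Spawned v x then h.choose else d

open Classical in
/-- The fork whose right child is `r`; a junk value if there is no such fork. -/
noncomputable def forkOf (G : FutureGraph V) (r : V) : V :=
  if h : ∃ v, G.next v = some r then h.choose else r

theorem nextFork_eq (h : G.IsStructuredSingleTouch) {d z x v : V} (hd : G.Spawned d z)
    (hz : G.touch z = some x) (hv : G.Spawned v x) : G.nextFork d = v := by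
  have hex : ∃ v z x, G.Spawned d z ∧ G.touch z = some x ∧ G.Spawned v x := ⟨v, z, x, hd, hz, hv⟩
  unfold nextFork
  rw [dif_pos hex]
  obtain ⟨z', x', h1, h2, h3⟩ := hex.choose_spec
  obtain rfl := h.touch_unique hd h1 hz h2
  rw [hz] at h2
  cases h2
  exact h.spawned_unique h3 hv

theorem forkOf_eq (h : G.IsStructuredSingleTouch) {v r : V} (hv : G.next v = some r) :
    G.forkOf r = v := by
  have hex : ∃ v, G.next v = some r := ⟨v, hv⟩
  unfold forkOf
  rw [dif_pos hex]
  exact h.next_inj _ _ _ hex.choose_spec hv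

/-- A disturbed fork is the end of a chain of forks which starts at a fork whose right child has
been stolen, and in which the future thread of every fork is touched by that of the next one. The
last nodes of these threads lie on a directed path, which bounds the length of the chain. -/
theorem Disturbed.exists_chain [Finite V] (h : G.IsStructuredSingleTouch) {St Lt : Set V}
    (hLt : ∀ d ∈ Lt, G.Disturbed St Lt d) {d z x : V} (hd : G.Disturbed St Lt d)
    (hz : G.Spawned d z) (hx : G.touch z = some x) :
    ∃ r ∈ St, ∃ i ≤ G.depth z, G.nextFork^[i] (G.forkOf r) = d := by
  induction hn : G.depth z using Nat.strong_induction_on generalizing d z x with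
  | _ n ih =>
    subst hn
    rcases hd with ⟨w, r, h1, h2, h3⟩ | ⟨d', hd', z', x', h1, h2, h3⟩
    · exact ⟨r, h3, 0, Nat.zero_le _, forkOf_eq h h2⟩
    · have hlt : G.depth z' < G.depth z := by
        refine (depth_lt_of_edge h.acyclic (Or.inr (Or.inr h2))).trans_le ?_
        -- the touch `x'` lies on the thread that ends with `z`
        obtain ⟨z'', x'', h4, h5, h6, -⟩ := h.exists_inThread_touch h3
        rw [← h.touch_unique h5 hz h6 hx]
        exact h4.reach.depth_le h.acyclic
      obtain ⟨r, hr, i, hi, he⟩ := ih _ hlt (hLt d' hd') h1 h2 rfl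
      refine ⟨r, hr, i + 1, by omega, ?_⟩
      rw [Function.iterate_succ_apply', he]
      exact nextFork_eq h h1 h2 h3

theorem Disturbed.exists_touch (h : G.IsStructuredSingleTouch) {St Lt : Set V} {d : V}
    (hd : G.Disturbed St Lt d) : ∃ z x, G.Spawned d z ∧ G.touch z = some x := by
  rcases hd with ⟨w, r, h1, -⟩ | ⟨-, -, -, -, -, -, w, h1, -⟩
  · exact h.exists_last h1
  · exact h.exists_last h1

theorem ncard_disturbed_le [Finite V] (h : G.IsStructuredSingleTouch) {St Lt : Set V}
    (hLt : ∀ d ∈ Lt, G.Disturbed St Lt d) :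
    {d | G.Disturbed St Lt d}.ncard ≤ St.ncard * G.span := by
  have hsub : {d | G.Disturbed St Lt d} ⊆
      (fun q : V × ℕ => G.nextFork^[q.2] (G.forkOf q.1)) '' (St ×ˢ Set.Iio G.span) := by
    intro d hd
    obtain ⟨z, x, hz, hx⟩ := hd.exists_touch h
    obtain ⟨r, hr, i, hi, he⟩ := hd.exists_chain h hLt hz hx
    have h1 := depth_lt_of_edge h.acyclic (Or.inr (Or.inr hx) : G.Edge z x)
    have h2 := depth_le_span h.acyclic x
    exact ⟨(r, i), ⟨hr, by simp only [Set.mem_Iio]; omega⟩, he⟩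
  have hfin : (St ×ˢ Set.Iio G.span).Finite := (Set.toFinite St).prod (Set.finite_Iio _)
  refine (Set.ncard_le_ncard hsub (hfin.image _)).trans ((Set.ncard_image_le hfin).trans ?_)
  rw [Set.ncard_prod]
  simp

theorem ncard_exceptional_le [Finite V] (h : G.IsStructuredSingleTouch) {St Lt : Set V}
    (hLt : ∀ d ∈ Lt, G.Disturbed St Lt d) :
    {b | G.Exceptional St Lt b}.ncard ≤ 2 * (St.ncard * G.span) := by
  classical
  have hD := ncard_disturbed_le h hLt
  have hsub : {b | G.Exceptional St Lt b} ⊆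
      (fun d => if hd : ∃ x z, G.Spawned d z ∧ G.touch z = some x
        then hd.choose else d) '' {d | G.Disturbed St Lt d} ∪
      (fun d => (G.next d).getD d) '' {d | G.Disturbed St Lt d} := by
    rintro b (⟨d, hd, z, hz, hb⟩ | ⟨v, w, h1, h2, h3⟩)
    · refine Or.inl ⟨d, hLt d hd, ?_⟩
      have hex : ∃ x z, G.Spawned d z ∧ G.touch z = some x := ⟨b, z, hz, hb⟩
      simp only [dif_pos hex]
      obtain ⟨z', h1, h2⟩ := hex.choose_spec
      rw [h.touch_unique h1 hz h2 hb, hb] at h2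
      exact (Option.some.inj h2).symm
    · exact Or.inr ⟨v, h3, by simp [h2]⟩
  have h1 := Set.ncard_le_ncard hsub (Set.toFinite _)
  have h2 := Set.ncard_union_le ((fun d => if hd : ∃ x z, G.Spawned d z ∧ G.touch z = some x
        then hd.choose else d) '' {d | G.Disturbed St Lt d})
      ((fun d => (G.next d).getD d) '' {d | G.Disturbed St Lt d})
  have h3 := Set.ncard_image_le (f := fun d =>
    if hd : ∃ x z, G.Spawned d z ∧ G.touch z = some x then hd.choose else d)
    (Set.toFinite {d | G.Disturbed St Lt d})
  have h4 := Set.ncard_image_le (f := fun d => (G.next d).getD d)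
    (Set.toFinite {d | G.Disturbed St Lt d})
  omega

end FutureGraph

/-! ### Deviations of a run -/

namespace WorkStealing

open WSState

variable {V : Type u} {P : ℕ} {G : FutureGraph V} {p₀ : Fin P} {A : Scheduler P} {x : ℕ → Fin P}

/-- The nodes that are stolen by the action at time `n`. -/
def stolenAt (G : FutureGraph V) (p₀ : Fin P) (A : Scheduler P) (x : ℕ → Fin P) (n : ℕ) : Set V :=
  (run G p₀ A x n).stolenBy (actor A x n) (x n)

/-- The nodes that are stolen before time `n`. -/
def stolen (G : FutureGraph V) (p₀ : Fin P) (A : Scheduler P) (x : ℕ → Fin P) (n : ℕ) : Set V :=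
  {a | ∃ m < n, a ∈ stolenAt G p₀ A x m}

/-- The forks that are late at a time up to `n`. -/
def lateForks (G : FutureGraph V) (p₀ : Fin P) (A : Scheduler P) (x : ℕ → Fin P) (n : ℕ) : Set V :=
  {d | ∃ m ≤ n, (run G p₀ A x m).Late G d}

/-- The nodes that may be deviations, as far as the actions before time `n` tell. -/
def exceptional (G : FutureGraph V) (p₀ : Fin P) (A : Scheduler P) (x : ℕ → Fin P) (n : ℕ) :
    Set V :=
  {b | G.Exceptional (stolen G p₀ A x n) (lateForks G p₀ A x n) b}

open Classical in
/-- The number of successful steals before time `n`. -/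
noncomputable def steals (G : FutureGraph V) (p₀ : Fin P) (A : Scheduler P) (x : ℕ → Fin P)
    (n : ℕ) : ℕ :=
  ((Finset.range n).filter fun m => (stolenAt G p₀ A x m).Nonempty).card

theorem inv_run [Finite V] (h : G.IsStructuredSingleTouch) (n : ℕ) : (run G p₀ A x n).Inv G := by
  induction n with
  | zero => exact inv_init h p₀
  | succ n ih => exact ih.step h _ _

theorem stolen_succ (n : ℕ) :
    stolen G p₀ A x (n + 1) = stolenAt G p₀ A x n ∪ stolen G p₀ A x n := by
  ext a
  simp only [stolen, Set.mem_ofPred_eq, Set.mem_union]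
  constructor
  · rintro ⟨m, hm, ha⟩
    rcases Nat.lt_succ_iff_lt_or_eq.1 hm with hm | rfl
    · exact Or.inr ⟨m, hm, ha⟩
    · exact Or.inl ha
  · rintro (ha | ⟨m, hm, ha⟩)
    · exact ⟨n, by omega, ha⟩
    · exact ⟨m, by omega, ha⟩

theorem lateForks_succ (n : ℕ) : lateForks G p₀ A x (n + 1) =
    lateForks G p₀ A x n ∪ {d | (run G p₀ A x (n + 1)).Late G d} := by
  ext a
  simp only [lateForks, Set.mem_ofPred_eq, Set.mem_union]
  constructor
  · rintro ⟨m, hm, ha⟩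
    rcases Nat.le_succ_iff.1 hm with hm | rfl
    · exact Or.inl ⟨m, hm, ha⟩
    · exact Or.inr ha
  · rintro (⟨m, hm, ha⟩ | ha)
    · exact ⟨m, by omega, ha⟩
    · exact ⟨n + 1, le_rfl, ha⟩

theorem trace_run [Finite V] (h : G.IsStructuredSingleTouch) (n : ℕ) :
    (run G p₀ A x n).Trace G (stolen G p₀ A x n) (lateForks G p₀ A x n) := by
  induction n with
  | zero =>
    have h1 : stolen G p₀ A x 0 = ∅ := by
      ext a
      simp [stolen]
    have h2 : lateForks G p₀ A x 0 = ∅ := by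
      ext a
      simp only [lateForks, Nat.le_zero, exists_eq_left, Set.mem_ofPred_eq, Set.mem_empty_iff_false,
        iff_false]
      exact (trace_init p₀).late_mem a
    rw [h1, h2]
    exact trace_init p₀
  | succ n ih =>
    rw [stolen_succ, lateForks_succ]
    exact ih.step h (inv_run h n) _ _

theorem exceptional_mono {m n : ℕ} (hmn : m ≤ n) :
    exceptional G p₀ A x m ⊆ exceptional G p₀ A x n := by
  have h1 : stolen G p₀ A x m ⊆ stolen G p₀ A x n := by
    rintro a ⟨k, hk, ha⟩
    exact ⟨k, hk.trans_le hmn, ha⟩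
  have h2 : lateForks G p₀ A x m ⊆ lateForks G p₀ A x n := by
    rintro a ⟨k, hk, ha⟩
    exact ⟨k, hk.trans hmn, ha⟩
  exact fun _ hb => FutureGraph.Exceptional.mono h1 h2 hb

theorem subsingleton_stolenAt (n : ℕ) : (stolenAt G p₀ A x n).Subsingleton := by
  rintro a ⟨-, -, ha⟩ b ⟨-, -, hb⟩
  rw [ha] at hb
  exact Option.some.inj hb

theorem ncard_stolen_le [Finite V] (n : ℕ) :
    (stolen G p₀ A x n).ncard ≤ steals G p₀ A x n := by
  induction n with
  | zero => simp [stolen]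
  | succ n ih =>
    rw [stolen_succ]
    unfold steals at ih ⊢
    rw [Finset.range_add_one, Finset.filter_insert]
    split
    · rw [Finset.card_insert_of_notMem (by simp)]
      have h1 := Set.ncard_union_le (stolenAt G p₀ A x n) (stolen G p₀ A x n)
      have h2 : (stolenAt G p₀ A x n).ncard ≤ 1 :=
        Set.ncard_le_one_iff_subsingleton.2 (subsingleton_stolenAt n)
      omega
    · rename_i he
      rw [Set.not_nonempty_iff_eq_empty.1 he, Set.empty_union]
      exact ih

theorem ncard_exceptional_le [Finite V] (h : G.IsStructuredSingleTouch) (n : ℕ) :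
    (exceptional G p₀ A x n).ncard ≤ 2 * (steals G p₀ A x n * G.span) :=
  (FutureGraph.ncard_exceptional_le h (trace_run h n).late_disturbed).trans
    (Nat.mul_le_mul_left _ (Nat.mul_le_mul_right _ (ncard_stolen_le n)))

/-! ### The sequential execution -/

/-- The sequential execution. -/
noncomputable abbrev seqRun (G : FutureGraph V) (n : ℕ) : WSState V 1 :=
  run G 0 (fun _ _ => 0) (fun _ => 0) n

theorem not_exceptional_seqRun [Finite V] (h : G.IsStructuredSingleTouch) (n : ℕ) (b : V) :
    ¬ G.Exceptional (stolen G (0 : Fin 1) (fun _ _ => 0) (fun _ => 0) n)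
      (lateForks G (0 : Fin 1) (fun _ _ => 0) (fun _ => 0) n) b := by
  have hno : ∀ d, ¬ G.Disturbed (stolen G (0 : Fin 1) (fun _ _ => 0) (fun _ => 0) n)
      (lateForks G (0 : Fin 1) (fun _ _ => 0) (fun _ => 0) n) d := by
    intro d hd
    obtain ⟨z, x, hz, hx⟩ := hd.exists_touch h
    obtain ⟨r, ⟨m, -, -, hr1, hr2⟩, -⟩ := hd.exists_chain h (trace_run h n).late_disturbed hz hx
    rw [Subsingleton.elim (actor _ _ m) 0] at hr1
    simp [hr1] at hr2
  rintro (⟨d, hd, -⟩ | ⟨v, w, -, -, hd⟩)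
  · exact hno d ((trace_run h n).late_disturbed d hd)
  · exact hno v hd

theorem seqRun_history_step [Finite V] (h : G.IsStructuredSingleTouch) {n : ℕ} {l r : List V}
    {b : V} (hl : (seqRun G n).history 0 = l ++ b :: r) :
    (l = [] ∧ b = G.root) ∨ ∃ a, l.getLast? = some a ∧ G.SeqStep a b := by
  rcases (trace_run h n).history_step 0 l b r hl with h1 | h1 | h1
  · exact Or.inl h1
  · exact Or.inr h1
  · exact absurd h1 (not_exceptional_seqRun h n b)

theorem SeqBefore.seqStep [Finite V] (h : G.IsStructuredSingleTouch) {a b : V}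
    (hab : SeqBefore G a b) : G.SeqStep a b := by
  obtain ⟨n, s, t, hst⟩ := hab
  rcases seqRun_history_step h (n := n) (l := s ++ [a]) (b := b) (r := t)
    (by rw [← hst]; simp) with ⟨h1, -⟩ | ⟨a', h1, h2⟩
  · simp at h1
  · simp at h1
    rwa [h1]

theorem IsDeviation.mem_exceptional [Finite V] (h : G.IsStructuredSingleTouch) {b : V}
    (hb : IsDeviation G p₀ A x b) : ∃ n, b ∈ exceptional G p₀ A x n := by
  obtain ⟨⟨n, p, hp⟩, a, hab, hne⟩ := hb
  have hab' := hab.seqStep h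
  obtain ⟨l, r, hl⟩ := List.append_of_mem hp
  rcases (trace_run h n).history_step p l b r hl with ⟨-, h1⟩ | ⟨a', h1, h2⟩ | h1
  · obtain ⟨c, hc⟩ := hab'.exists_edge
    exact absurd h1 (h.ne_root_of_edge hc)
  · exfalso
    obtain rfl := h2.left_unique h hab'
    obtain ⟨l', rfl⟩ := List.getLast?_eq_some_iff.1 h1
    exact hne p ⟨n, l', r, by rw [hl]; simp⟩
  · exact ⟨n, h1⟩

theorem exists_deviations_le [Finite V] (h : G.IsStructuredSingleTouch) :
    ∃ n, deviations G p₀ A x ≤ 2 * (steals G p₀ A x n * G.span) := by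
  classical
  have hfin : {b | IsDeviation G p₀ A x b}.Finite := Set.toFinite _
  have : ∀ b : V, ∃ n, IsDeviation G p₀ A x b → b ∈ exceptional G p₀ A x n := by
    intro b
    by_cases hb : IsDeviation G p₀ A x b
    · obtain ⟨n, hn⟩ := hb.mem_exceptional h
      exact ⟨n, fun _ => hn⟩
    · exact ⟨0, fun h => absurd h hb⟩
  choose f hf using this
  obtain ⟨N, hN⟩ : ∃ N, ∀ b, f b ≤ N := by
    obtain ⟨N, hN⟩ := (Set.finite_range f).bddAbove
    exact ⟨N, fun b => hN ⟨b, rfl⟩⟩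
  refine ⟨N, le_trans (Set.ncard_le_ncard ?_ (Set.toFinite _)) (ncard_exceptional_le h N)⟩
  intro b hb
  exact exceptional_mono (hN b) (hf b hb)

/-- Some node is ready as long as there are unexecuted nodes. -/
theorem exists_ready [Finite V] (h : G.IsStructuredSingleTouch) (s : WSState V P)
    {v : V} (hv : ¬ s.Executed v) : ∃ u, ¬ s.Executed u ∧ s.Ready G u := by
  induction hn : G.depth v using Nat.strong_induction_on generalizing v with
  | _ n ih =>
    subst hn
    by_cases hr : s.Ready G v
    · exact ⟨v, hv, hr⟩
    · simp only [Ready, not_forall] at hr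
      obtain ⟨a, ha, hae⟩ := hr
      exact ih _ (FutureGraph.depth_lt_of_edge h.acyclic ha) hae rfl

/-- The sequential execution executes all nodes. -/
theorem exists_seqRun_complete [Finite V] (h : G.IsStructuredSingleTouch) :
    ∃ n, ∀ v, v ∈ (seqRun G n).history 0 := by
  classical
  by_contra hcon
  push Not at hcon
  have hgrow : ∀ n, n ≤ 2 * ((seqRun G n).history 0).length +
      if (seqRun G n).current 0 = none then 0 else 1 := by
    intro n
    induction n with
    | zero => simp
    | succ n ih =>
      obtain ⟨v, hv⟩ := hcon n
      have hne : ¬ (seqRun G n).Executed v := by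
        rintro ⟨p, hp⟩
        rw [Subsingleton.elim p 0] at hp
        exact hv hp
      obtain ⟨u, hu1, hu2⟩ := exists_ready h _ hne
      obtain ⟨p, hp⟩ := (inv_run h n).complete u hu1 hu2
      rw [Subsingleton.elim p 0] at hp
      have hstep := stepCase_step h (seqRun G n) 0 0
      change n + 1 ≤ 2 * (((seqRun G n).step G 0 0).history 0).length +
        if ((seqRun G n).step G 0 0).current 0 = none then 0 else 1
      generalize (seqRun G n).step G 0 0 = s' at hstep ⊢
      cases hstep with
      | exec v c h1 h2 =>
        rw [if_neg (by simp [h1])] at ih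
        rw [history_execute_self]
        simp only [List.length_append, List.length_singleton]
        omega
      | pop a d h1 h2 =>
        rw [if_pos h1] at ih
        rw [if_neg (by simp [WSState.pop])]
        simp only [WSState.pop]
        omega
      | steal a l h1 h2 h3 h4 => exact absurd rfl h4
      | fail h1 h2 h3 =>
        simp [pending, h1, h2] at hp
  have hlen : ∀ n, ((seqRun G n).history 0).length ≤ Nat.card V := by
    intro n
    have := Fintype.ofFinite V
    rw [Nat.card_eq_fintype_card]
    exact (List.nodup_append.1 ((inv_run h n).nodup 0)).1.length_le_card
  have h1 := hgrow (2 * Nat.card V + 2)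
  have h2 := hlen (2 * Nat.card V + 2)
  split at h1 <;> omega

/-! ### Cache misses -/

section Cache

variable {B : Type v} {C : ℕ}

open Classical in
/-- The content of an LRU cache with `C` lines after a sequence of memory accesses. -/
noncomputable def lruCache (C : ℕ) : List B → List B → List B
  | cache, [] => cache
  | cache, b :: bs => lruCache C ((b :: cache.erase b).take C) bs

theorem lruMisses_append (c as bs : List B) :
    lruMisses C c (as ++ bs) = lruMisses C c as + lruMisses C (lruCache C c as) bs := by
  induction as generalizing c with
  | nil => simp [lruMisses, lruCache]
  | cons a as ih =>
    simp only [List.cons_append, lruMisses, lruCache, ih]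
    omega

theorem lruCache_append (c as bs : List B) :
    lruCache C c (as ++ bs) = lruCache C (lruCache C c as) bs := by
  induction as generalizing c with
  | nil => simp [lruCache]
  | cons a as ih => simp only [List.cons_append, lruCache, ih]

theorem length_lruCache_le {c : List B} (hc : c.length ≤ C) (as : List B) :
    (lruCache C c as).length ≤ C := by
  induction as generalizing c with
  | nil => simpa [lruCache]
  | cons a as ih =>
    simp only [lruCache]
    exact ih (by rw [List.length_take]; exact min_le_left _ _)

/-- Two caches whose most recently used blocks `p` agree: when a block outside `p` is accessed, the
agreement grows by one block. -/
theorem lruMisses_le_add_sub (σ p c₁ c₂ : List B) (h₁ : (p ++ c₁).length ≤ C)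
    (h₂ : (p ++ c₂).length ≤ C) :
    lruMisses C (p ++ c₁) σ ≤ lruMisses C (p ++ c₂) σ + (C - p.length) := by
  classical
  induction σ generalizing p c₁ c₂ with
  | nil => simp [lruMisses]
  | cons b σ ih =>
    simp only [lruMisses]
    by_cases hb : b ∈ p
    · have key : ∀ c : List B, (p ++ c).length ≤ C →
          (b :: (p ++ c).erase b).take C = (b :: p.erase b) ++ c := by
        intro c hc
        rw [List.erase_append_left _ hb, List.cons_append]
        apply List.take_of_length_le
        have := List.length_erase_of_mem hb
        have := List.length_pos_of_mem hb
        simp at hc ⊢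
        omega
      have hlen : (b :: p.erase b).length = p.length := by
        have := List.length_erase_of_mem hb
        have := List.length_pos_of_mem hb
        simp
        omega
      have := ih (b :: p.erase b) c₁ c₂ (by simp at h₁ hlen ⊢; omega)
        (by simp at h₂ hlen ⊢; omega)
      rw [hlen, ← key c₁ h₁, ← key c₂ h₂] at this
      simp only [List.mem_append, hb, true_or, if_true]
      convert (by omega : 0 + lruMisses C (List.take C (b :: (p ++ c₁).erase b)) σ ≤
        0 + lruMisses C (List.take C (b :: (p ++ c₂).erase b)) σ + (C - p.length))
    · by_cases hC : p.length = C
      · have e₁ : c₁ = [] := List.eq_nil_of_length_eq_zero (by simp at h₁; omega)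
        have e₂ : c₂ = [] := List.eq_nil_of_length_eq_zero (by simp at h₂; omega)
        subst e₁ e₂
        exact Nat.le_add_right _ _
      have hlt : p.length < C := by simp at h₁; omega
      have key : ∀ c : List B, (b :: (p ++ c).erase b).take C =
          (b :: p) ++ (c.erase b).take (C - (p.length + 1)) := by
        intro c
        rw [List.erase_append_right _ hb, ← List.cons_append, List.take_append]
        rw [List.take_of_length_le (by simp; omega)]
        simp
      have := ih (b :: p) ((c₁.erase b).take (C - (p.length + 1)))
        ((c₂.erase b).take (C - (p.length + 1))) (by simp; omega) (by simp; omega)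
      rw [← key c₁, ← key c₂] at this
      simp only [List.length_cons] at this
      have h3 : (if b ∈ p ++ c₁ then 0 else 1) ≤ 1 := by split <;> omega
      convert (by omega : (if b ∈ p ++ c₁ then 0 else 1) +
        lruMisses C (List.take C (b :: (p ++ c₁).erase b)) σ ≤
        (if b ∈ p ++ c₂ then 0 else 1) + lruMisses C (List.take C (b :: (p ++ c₂).erase b)) σ +
          (C - p.length))

/-- Starting with another content of the cache costs at most `C` additional misses. -/
theorem lruMisses_le_add {c₁ c₂ : List B} (h₁ : c₁.length ≤ C) (h₂ : c₂.length ≤ C) (σ : List B) :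
    lruMisses C c₁ σ ≤ lruMisses C c₂ σ + C := by
  simpa using lruMisses_le_add_sub σ [] c₁ c₂ h₁ h₂

open Classical in
/-- The content of the cache immediately before `b` when the nodes of `H` are executed in order. -/
noncomputable def cacheBefore (C : ℕ) (acc : V → List B) (H : List V) (b : V) : List B :=
  lruCache C [] ((H.take (H.idxOf b)).flatMap acc)

/-- The number of misses of `b` when the nodes of `H` are executed in order. -/
noncomputable def missesOf (C : ℕ) (acc : V → List B) (H : List V) (b : V) : ℕ :=
  lruMisses C (cacheBefore C acc H b) (acc b)

variable {acc : V → List B} {H : List V}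

theorem cacheBefore_eq (hH : H.Nodup) {l r : List V} {b : V} (hl : H = l ++ b :: r) :
    cacheBefore C acc H b = lruCache C [] (l.flatMap acc) := by
  classical
  have hb : b ∉ l := by
    intro hb
    rw [hl] at hH
    exact List.disjoint_of_nodup_append hH hb (by simp)
  unfold cacheBefore
  rw [hl, List.idxOf_append_of_notMem hb]
  simp

theorem length_cacheBefore_le (b : V) : (cacheBefore C acc H b).length ≤ C :=
  length_lruCache_le (Nat.zero_le _) _

theorem sum_missesOf (hH : H.Nodup) :
    (H.map (missesOf C acc H)).sum = lruMisses C [] (H.flatMap acc) := by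
  suffices ∀ l r, H = l ++ r → (l.map (missesOf C acc H)).sum = lruMisses C [] (l.flatMap acc) from
    this H [] (by simp)
  intro l
  induction l using List.reverseRecOn with
  | nil => simp [lruMisses]
  | append_singleton l b ih =>
    intro r hr
    rw [List.append_assoc, List.singleton_append] at hr
    rw [List.map_append, List.sum_append, ih _ hr, List.flatMap_append, lruMisses_append]
    simp [missesOf, cacheBefore_eq hH hr]

open Classical in
/-- Let the list `h` be executed with an empty cache. Every node of `h` that does not follow its
predecessor in `H`, and is not the first node of both lists, costs at most `C` misses more than in
the execution of `H`, as the two caches may differ when it is executed. -/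
theorem lruMisses_le_sum (hH : H.Nodup) {root : V} {S : V → V → Prop}
    {D : Set V} (hroot : ∃ r, H = root :: r) (hS : ∀ a b, S a b → ∃ l r, H = l ++ a :: b :: r)
    (h : List V) (hh : ∀ l b r, h = l ++ b :: r →
      (l = [] ∧ b = root) ∨ (∃ a, l.getLast? = some a ∧ S a b) ∨ b ∈ D) :
    lruMisses C [] (h.flatMap acc) ≤
      (h.map fun b => missesOf C acc H b + if b ∈ D then C else 0).sum := by
  suffices ∀ σ, lruMisses C [] (h.flatMap acc ++ σ) ≤
      (h.map fun b => missesOf C acc H b + if b ∈ D then C else 0).sum +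
        lruMisses C (h.getLast?.elim [] fun a => lruCache C (cacheBefore C acc H a) (acc a)) σ by
    simpa [lruMisses] using this []
  induction h using List.reverseRecOn with
  | nil => simp
  | append_singleton h b ih =>
    intro σ
    have ih' := ih (fun l b' r hl => hh l b' (r ++ [b]) (by rw [hl]; simp)) (acc b ++ σ)
    simp only [List.flatMap_append, List.flatMap_singleton, List.append_assoc, List.map_append,
      List.map_singleton, List.sum_append, List.sum_singleton, List.getLast?_append,
      List.getLast?_singleton, Option.some_or, Option.elim_some]
    refine ih'.trans ?_
    have hlast : (h.getLast?.elim [] fun a =>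
        lruCache C (cacheBefore C acc H a) (acc a)).length ≤ C := by
      cases h.getLast? with
      | none => simp
      | some a => exact length_lruCache_le (length_cacheBefore_le a) _
    have hsplit : lruMisses C (cacheBefore C acc H b) (acc b ++ σ) = missesOf C acc H b +
        lruMisses C (lruCache C (cacheBefore C acc H b) (acc b)) σ := lruMisses_append _ _ _
    rcases hh h b [] rfl with ⟨rfl, rfl⟩ | ⟨a, h1, h2⟩ | hb
    · obtain ⟨r, hr⟩ := hroot
      have : cacheBefore C acc H b = [] := by
        rw [cacheBefore_eq hH (l := []) hr]
        simp [lruCache]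
      rw [this] at hsplit
      simp only [List.getLast?_nil, Option.elim_none]
      rw [this]
      omega
    · obtain ⟨l, r, hl⟩ := hS a b h2
      have e1 := cacheBefore_eq (C := C) (acc := acc) hH hl
      have e2 := cacheBefore_eq (C := C) (acc := acc) hH (l := l ++ [a]) (b := b) (r := r)
        (by rw [hl]; simp)
      rw [List.flatMap_append, lruCache_append, ← e1, List.flatMap_singleton] at e2
      rw [h1]
      simp only [Option.elim_some]
      rw [← e2]
      omega
    · have := lruMisses_le_add hlast (length_cacheBefore_le (acc := acc) (H := H) b) (acc b ++ σ)
      rw [if_pos hb]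
      omega

end Cache

/-- Up to any time the cache misses exceed those of the sequential execution by at most `C` for
every exceptional node. -/
theorem sum_lruMisses_le [Finite V] (h : G.IsStructuredSingleTouch) {B : Type v} (C : ℕ)
    (acc : V → List B) (n : ℕ) :
    ((∑ p, lruMisses C [] (((run G p₀ A x n).history p).flatMap acc) : ℕ) : ℝ≥0∞) ≤
      seqMisses C acc G + (C * (exceptional G p₀ A x n).ncard : ℕ) := by
  classical
  have := Fintype.ofFinite V
  obtain ⟨N, hN⟩ := exists_seqRun_complete h
  set H := (seqRun G N).history 0 with hHdef
  have hH : H.Nodup := (List.nodup_append.1 ((inv_run h N).nodup 0)).1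
  have hseq : (lruMisses C [] (H.flatMap acc) : ℝ≥0∞) ≤ seqMisses C acc G := by
    refine le_trans (le_of_eq ?_) (le_iSup _ N)
    simp [hHdef]
  refine le_trans ?_ (add_le_add_left hseq _)
  rw [← Nat.cast_add, Nat.cast_le]
  have hroot : ∃ r, H = G.root :: r := by
    cases hH' : H with
    | nil => simpa [hH'] using hN G.root
    | cons b r =>
      rcases seqRun_history_step h (n := N) (l := []) (b := b) (r := r) hH' with
        ⟨-, rfl⟩ | ⟨a, ha, -⟩
      · exact ⟨r, rfl⟩
      · simp at ha
  have hS : ∀ a b, G.SeqStep a b → ∃ l r, H = l ++ a :: b :: r := by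
    intro a b hab
    obtain ⟨l, r, hl⟩ := List.append_of_mem (hN b)
    rcases seqRun_history_step h hl with ⟨-, rfl⟩ | ⟨a', h1, h2⟩
    · obtain ⟨c, hc⟩ := hab.exists_edge
      exact absurd rfl (h.ne_root_of_edge hc)
    · obtain rfl := h2.left_unique h hab
      obtain ⟨l', rfl⟩ := List.getLast?_eq_some_iff.1 h1
      exact ⟨l', r, by rw [hl]; simp⟩
  set D := exceptional G p₀ A x n with hD
  set f : V → ℕ := fun b => missesOf C acc H b + if b ∈ D then C else 0 with hf
  have hnd : ∀ p, ((run G p₀ A x n).history p).Nodup := fun p =>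
    (List.nodup_append.1 ((inv_run h n).nodup p)).1
  calc ∑ p, lruMisses C [] (((run G p₀ A x n).history p).flatMap acc)
      ≤ ∑ p, (((run G p₀ A x n).history p).map f).sum := by
        refine Finset.sum_le_sum fun p _ => ?_
        have := lruMisses_le_sum (C := C) (acc := acc) (D := D) hH hroot hS
          ((run G p₀ A x n).history p) ((trace_run h n).history_step p)
        convert this
    _ = ∑ p, ∑ b ∈ ((run G p₀ A x n).history p).toFinset, f b := by
        refine Finset.sum_congr rfl fun p _ => ?_
        rw [List.sum_toFinset _ (hnd p)]
    _ = ∑ b ∈ Finset.univ.biUnion fun p => ((run G p₀ A x n).history p).toFinset, f b := by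
        rw [Finset.sum_biUnion]
        intro p _ q _ hpq
        rw [Function.onFun, Finset.disjoint_left]
        intro b hb hb'
        rw [List.mem_toFinset] at hb hb'
        exact hpq ((inv_run h n).disj p q b (List.mem_append_left _ hb)
          (List.mem_append_left _ hb'))
    _ ≤ ∑ b, f b := Finset.sum_le_sum_of_subset (Finset.subset_univ _)
    _ = lruMisses C [] (H.flatMap acc) + C * D.ncard := by
        rw [hf, Finset.sum_add_distrib, ← sum_missesOf hH, ← List.sum_toFinset _ hH]
        congr 1
        · congr 1
          ext b
          simp only [Finset.mem_univ, List.mem_toFinset, true_iff]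
          exact hN b
        · rw [← Finset.sum_filter, Finset.sum_const, smul_eq_mul, mul_comm,
            Set.ncard_eq_toFinset_card' D]
          congr 2
          ext b
          simp

end WorkStealing

/-! ### The potential -/

namespace WSState

variable {V : Type u} {P : ℕ} {G : FutureGraph V}

/-- The weight of a node, which decreases by a factor `9` at least along every edge. -/
noncomputable def weight (G : FutureGraph V) (v : V) : ℝ := 9 ^ (G.span - G.depth v)

theorem weight_pos (v : V) : 0 < weight G v := by unfold weight; positivity

theorem one_le_weight (v : V) : 1 ≤ weight G v := one_le_pow₀ (by norm_num)

theorem weight_le_of_depth_le {a b : V} (h : G.depth a ≤ G.depth b) :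
    weight G b ≤ weight G a :=
  pow_le_pow_right₀ (by norm_num) (by omega)

theorem weight_le_of_depth_lt [Finite V] (hac : ∀ v, ¬ G.Desc v v) {a b : V}
    (h : G.depth a < G.depth b) : 9 * weight G b ≤ weight G a := by
  have h1 := FutureGraph.depth_le_span hac b
  unfold weight
  rw [← pow_succ']
  exact pow_le_pow_right₀ (by norm_num) (by omega)

/-- The total weight of a list of nodes. -/
noncomputable def listWeight (G : FutureGraph V) (l : List V) : ℝ := (l.map (weight G)).sum

@[simp] theorem listWeight_nil : listWeight G [] = 0 := by simp [listWeight]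

@[simp] theorem listWeight_cons (a : V) (l : List V) :
    listWeight G (a :: l) = weight G a + listWeight G l := by simp [listWeight]

@[simp] theorem listWeight_append (l l' : List V) :
    listWeight G (l ++ l') = listWeight G l + listWeight G l' := by simp [listWeight]

theorem listWeight_nonneg (l : List V) : 0 ≤ listWeight G l :=
  List.sum_nonneg (by simpa using fun a _ => (weight_pos a).le)

/-- The potential of a processor. A node in the deque counts three times as much as the node that
the processor is about to execute, so that the potential also decreases when a node is popped or
stolen. -/
noncomputable def potential (G : FutureGraph V) (s : WSState V P) (q : Fin P) : ℝ :=
  listWeight G (s.current q).toList + 3 * listWeight G (s.deque q)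

/-- A lower bound for the decrease of the potential when the top node of the deque is stolen. -/
noncomputable def topGain (G : FutureGraph V) (s : WSState V P) (q : Fin P) : ℝ :=
  (s.deque q).getLast?.elim 0 fun a => 3 / 2 * weight G a

/-- A lower bound for the decrease of the potential when a processor whose deque is empty acts. -/
noncomputable def soleGain (G : FutureGraph V) (s : WSState V P) (q : Fin P) : ℝ :=
  if s.deque q = [] then 1 / 2 * listWeight G (s.current q).toList else 0

/-- The decrease of the potential that is to be expected from `q` within a round with `j` further
attempts to steal: each of them hits `q` with probability `1 / P`, and a processor whose deque is
empty acts before the end of the round. -/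
noncomputable def gain (G : FutureGraph V) (s : WSState V P) (j : ℕ) (q : Fin P) : ℝ :=
  topGain G s q * (1 - (1 - (P : ℝ)⁻¹) ^ j) + soleGain G s q

open Classical in
/-- The potential less the decrease that is to be expected from the processors in `pend`. -/
noncomputable def restPotential (G : FutureGraph V) (s : WSState V P) (pend : Finset (Fin P))
    (j : ℕ) : ℝ :=
  ∑ q, (potential G s q - if q ∈ pend then gain G s j q else 0)

open Classical in
/-- The processors in `pend` from which no decrease has been realized by the action of `p` that
leads from `s` to `s'`. -/
noncomputable def keep (s s' : WSState V P) (p : Fin P) (pend : Finset (Fin P)) :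
    Finset (Fin P) :=
  pend.filter fun q => (s'.deque q).getLast? = (s.deque q).getLast? ∧ (s.deque q = [] → q ≠ p)

theorem mem_keep {s s' : WSState V P} {p q : Fin P} {pend : Finset (Fin P)} :
    q ∈ keep s s' p pend ↔ q ∈ pend ∧ (s'.deque q).getLast? = (s.deque q).getLast? ∧
      (s.deque q = [] → q ≠ p) := by
  simp [keep]

theorem inv_P_le_one (p : Fin P) : 0 ≤ 1 - (P : ℝ)⁻¹ ∧ 1 - (P : ℝ)⁻¹ ≤ 1 := by
  have hP : (1 : ℝ) ≤ P := by exact_mod_cast p.pos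
  have h1 : (P : ℝ)⁻¹ ≤ 1 := inv_le_one_of_one_le₀ hP
  have h2 : 0 ≤ (P : ℝ)⁻¹ := by positivity
  constructor <;> linarith

theorem potential_nonneg (s : WSState V P) (q : Fin P) : 0 ≤ potential G s q := by
  have h1 := listWeight_nonneg (G := G) (s.current q).toList
  have h2 := listWeight_nonneg (G := G) (s.deque q)
  unfold potential
  linarith

theorem topGain_nonneg (s : WSState V P) (q : Fin P) : 0 ≤ topGain G s q := by
  unfold topGain
  cases (s.deque q).getLast? with
  | none => simp
  | some a =>
    have := weight_pos (G := G) a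
    simp only [Option.elim_some]
    linarith

theorem gain_le_potential (s : WSState V P) (j : ℕ) (q : Fin P) :
    gain G s j q ≤ potential G s q := by
  have h1 := listWeight_nonneg (G := G) (s.current q).toList
  obtain ⟨h2, h3⟩ := inv_P_le_one q
  have h4 : topGain G s q * (1 - (1 - (P : ℝ)⁻¹) ^ j) ≤ topGain G s q := by
    have := topGain_nonneg (G := G) s q
    have : 0 ≤ (1 - (P : ℝ)⁻¹) ^ j := by positivity
    nlinarith
  refine (add_le_add_left h4 _).trans ?_
  unfold potential topGain soleGain
  rcases List.eq_nil_or_concat (s.deque q) with hd | ⟨l, a, hd⟩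
  · simp only [hd, List.getLast?_nil, Option.elim_none, if_true, listWeight_nil]
    linarith
  · rw [List.concat_eq_append] at hd
    have h5 := listWeight_nonneg (G := G) l
    have h6 := weight_pos (G := G) a
    simp [hd]
    linarith

theorem restPotential_nonneg (s : WSState V P) (pend : Finset (Fin P)) (j : ℕ) :
    0 ≤ restPotential G s pend j := by
  refine Finset.sum_nonneg fun q _ => ?_
  have h1 := gain_le_potential (G := G) s j q
  have h2 := potential_nonneg (G := G) s q
  split <;> linarith

/-- The weights of the nodes in a deque increase geometrically from the bottom to the top. -/
theorem listWeight_le_of_isChain [Finite V] (h : G.IsStructuredSingleTouch) {b t : V} {l : List V}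
    (hl : (b :: l).IsChain fun x y => G.Under y x) (hr : ∀ x ∈ b :: l, G.IsRight x)
    (ht : (b :: l).getLast? = some t) :
    8 * listWeight G (b :: l) + weight G b ≤ 9 * weight G t := by
  induction l generalizing b with
  | nil =>
    simp at ht
    subst ht
    simp
    linarith
  | cons c l ih =>
    rw [List.isChain_cons_cons] at hl
    have h1 := ih hl.2 (fun x hx => hr x (List.mem_cons_of_mem _ hx)) (by simpa using ht)
    have h2 : 9 * weight G b ≤ weight G c := weight_le_of_depth_lt h.acyclic
      (h.depth_lt_of_under_isRight hl.1 (hr b (by simp)))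
    rw [listWeight_cons]
    linarith

/-- A constant part of the potential of every processor may be expected to vanish in a round. -/
theorem Inv.potential_le_gain [Finite V] (h : G.IsStructuredSingleTouch) {s : WSState V P}
    (hs : s.Inv G) {M : ℕ} (hM : (1 - (P : ℝ)⁻¹) ^ M ≤ 1 / 2) (q : Fin P) :
    potential G s q ≤ 6 * gain G s M q := by
  unfold gain potential topGain soleGain
  cases hd : s.deque q with
  | nil =>
    have h1 := listWeight_nonneg (G := G) (s.current q).toList
    simp
    linarith
  | cons b l =>
    obtain ⟨t, ht⟩ : ∃ t, (b :: l).getLast? = some t := ⟨_, List.getLast?_eq_some_getLast (by simp)⟩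
    have hst := hs.stack q
    have hright := hs.right q
    rw [hd] at hright
    have hch : (b :: l).IsChain fun x y => G.Under y x := by
      rw [pending, hd] at hst
      exact (List.isChain_append.1 hst).2.1
    have h1 := listWeight_le_of_isChain h hch hright ht
    have h2 : listWeight G (s.current q).toList ≤ weight G b := by
      cases hc : s.current q with
      | none => simpa using (weight_pos b).le
      | some u =>
        rw [pending, hd, hc] at hst
        simp only [Option.toList_some, List.singleton_append, List.isChain_cons_cons] at hst
        simpa using weight_le_of_depth_le (h.depth_le_of_under hst.1)
    have h3 := listWeight_nonneg (G := G) l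
    have h4 := weight_pos (G := G) t
    rw [ht]
    simp only [Option.elim_some, reduceCtorEq, if_false, add_zero]
    rw [listWeight_cons] at h1 ⊢
    have h5 : weight G t * (1 / 2) ≤ weight G t * (1 - (1 - (P : ℝ)⁻¹) ^ M) :=
      mul_le_mul_of_nonneg_left (by linarith) h4.le
    linarith

/-- An action which is not an attempt to steal does not increase the residual potential. -/
theorem restPotential_step_le [Finite V] (h : G.IsStructuredSingleTouch) {s : WSState V P}
    {p r : Fin P} (hp : ¬ s.WantsToSteal p) (pend : Finset (Fin P)) (j : ℕ) :
    restPotential G (s.step G p r) (keep s (s.step G p r) p pend) j ≤ restPotential G s pend j := by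
  have hstep := stepCase_step h s p r
  generalize s.step G p r = s' at hstep ⊢
  obtain ⟨ha0, ha1⟩ := inv_P_le_one p
  have hpow : 0 ≤ (1 - (P : ℝ)⁻¹) ^ j := by positivity
  -- the other processors are not affected
  have hother : ∀ q, q ≠ p → s'.current q = s.current q → s'.deque q = s.deque q →
      (potential G s' q - if q ∈ keep s s' p pend then gain G s' j q else 0) ≤
        (potential G s q - if q ∈ pend then gain G s j q else 0) := by
    intro q hq h1 h2
    have h3 : q ∈ keep s s' p pend ↔ q ∈ pend := by rw [mem_keep, h2]; simp [hq]
    simp only [h3, potential, gain, topGain, soleGain, h1, h2]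
    exact le_rfl
  refine Finset.sum_le_sum fun q _ => ?_
  cases hstep with
  | exec v c h1 h2 =>
    by_cases hq : q = p
    swap
    · exact hother q hq (by simp [execute, Function.update_of_ne hq])
        (by simp [execute, Function.update_of_ne hq])
    subst hq
    have hw : ∀ b ∈ c, 9 * weight G b ≤ weight G v := fun b hb =>
      weight_le_of_depth_lt h.acyclic (FutureGraph.depth_lt_of_edge h.acyclic (h2.edge hb))
    have hwv := weight_pos (G := G) v
    have hc : listWeight G c.head?.toList + 3 * listWeight G c.tail ≤ 4 / 9 * weight G v := by
      cases h2 with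
      | fork w r' =>
        have := hw w (by simp)
        have := hw r' (by simp)
        simp
        linarith
      | next b =>
        have := hw b (by simp)
        simp
        linarith
      | touch b =>
        have := hw b (by simp)
        simp
        linarith
      | none => simp; linarith
    have hpot : potential G (s.execute q v c) q ≤ potential G s q - 5 / 9 * weight G v := by
      simp only [potential, execute, Function.update_self, h1, Option.toList_some, listWeight_cons,
        listWeight_nil, listWeight_append]
      linarith
    by_cases hd : s.deque q = []
    · have h3 : q ∉ keep s (s.execute q v c) q pend := by
        rw [mem_keep]
        simp [hd]
      have h4 : gain G s j q = 1 / 2 * weight G v := by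
        simp [gain, topGain, soleGain, hd, h1]
      rw [if_neg h3, h4]
      split <;> linarith
    · have h5 : ((s.execute q v c).deque q).getLast? = (s.deque q).getLast? := by
        simp only [execute, Function.update_self]
        rw [List.getLast?_append_of_ne_nil _ hd]
      have h3 : q ∈ keep s (s.execute q v c) q pend ↔ q ∈ pend := by
        rw [mem_keep, h5]
        simp [hd]
      have h6 : (s.execute q v c).deque q ≠ [] := by simp [execute, hd]
      have h4 : gain G (s.execute q v c) j q = gain G s j q := by
        simp only [gain, topGain, soleGain, h5, if_neg hd, if_neg h6]
      simp only [h3, h4]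
      linarith
  | pop a d h1 h2 =>
    by_cases hq : q = p
    swap
    · exact hother q hq (by simp [pop, Function.update_of_ne hq])
        (by simp [pop, Function.update_of_ne hq])
    subst hq
    have hwa := weight_pos (G := G) a
    have hpot : potential G (s.pop q a d) q = potential G s q - 2 * weight G a := by
      simp only [potential, pop, Function.update_self, h1, h2, Option.toList_some, listWeight_cons,
        listWeight_nil, Option.toList_none]
      ring
    have hdq : (s.pop q a d).deque q = d := by simp [pop]
    by_cases hd : d = []
    · subst hd
      have h3 : q ∉ keep s (s.pop q a []) q pend := by
        rw [mem_keep]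
        simp [h2, hdq]
      have h4 : gain G s j q ≤ 3 / 2 * weight G a := by
        simp [gain, topGain, soleGain, h2]
        nlinarith
      rw [if_neg h3, hpot]
      split <;> linarith
    · have h5 : (a :: d).getLast? = d.getLast? := by
        cases d with
        | nil => exact absurd rfl hd
        | cons b d => simp
      have h3 : q ∈ keep s (s.pop q a d) q pend ↔ q ∈ pend := by
        rw [mem_keep, hdq, h2, h5]
        simp
      have h4 : gain G (s.pop q a d) j q = gain G s j q := by
        simp only [gain, topGain, soleGain, hdq, h2, h5, if_neg hd, reduceCtorEq, if_false]
      simp only [h3, h4]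
      linarith
  | steal a l h1 h2 h3 h4 => exact absurd ⟨h1, h2⟩ hp
  | fail h1 h2 h3 => exact absurd ⟨h1, h2⟩ hp

open Classical in
/-- The effect of an attempt to steal with victim `r`. -/
theorem restPotential_steal_le [Finite V] (h : G.IsStructuredSingleTouch) {s : WSState V P}
    (hs : s.Inv G) {p : Fin P} (hp : s.WantsToSteal p) (pend : Finset (Fin P)) (j : ℕ)
    (r : Fin P) :
    restPotential G (s.step G p r) (keep s (s.step G p r) p pend) j ≤ restPotential G s pend j -
      if r ∈ pend then topGain G s r * (1 - (P : ℝ)⁻¹) ^ j else 0 := by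
  have hstep := stepCase_step h s p r
  generalize s.step G p r = s' at hstep ⊢
  obtain ⟨ha0, ha1⟩ := inv_P_le_one p
  have hpow : 0 ≤ (1 - (P : ℝ)⁻¹) ^ j := by positivity
  obtain ⟨hp1, hp2⟩ := hp
  have hgp : gain G s j p = 0 := by simp [gain, topGain, soleGain, hp1, hp2]
  have hpp : potential G s p = 0 := by simp [potential, hp1, hp2]
  have hother : ∀ q, q ≠ p → s'.current q = s.current q → s'.deque q = s.deque q →
      (potential G s' q - if q ∈ keep s s' p pend then gain G s' j q else 0) =
        (potential G s q - if q ∈ pend then gain G s j q else 0) := by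
    intro q hq h1 h2
    have h3 : q ∈ keep s s' p pend ↔ q ∈ pend := by rw [mem_keep, h2]; simp [hq]
    simp only [h3, potential, gain, topGain, soleGain, h1, h2]
  have hkp : p ∉ keep s s' p pend := by
    rw [mem_keep]
    simp [hp2]
  cases hstep with
  | exec v c h1 h2 => simp [hp1] at h1
  | pop a d h1 h2 => simp [hp2] at h2
  | fail h1 h2 h3 =>
    have : topGain G s r = 0 := by simp [topGain, h3]
    rw [this]
    simp only [zero_mul, ite_self, sub_zero]
    refine Finset.sum_le_sum fun q _ => ?_
    by_cases hq : q = p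
    · subst hq
      rw [if_neg hkp, hgp]
      simp
    · exact (hother q hq rfl rfl).le
  | steal a l h1 h2 h3 h4 =>
    have hwa := weight_pos (G := G) a
    have hgr : topGain G s r = 3 / 2 * weight G a := by simp [topGain, h3]
    -- what the thief gains, and what the victim loses
    have key : ∀ q, (potential G (s.steal p r a) q -
        if q ∈ keep s (s.steal p r a) p pend then gain G (s.steal p r a) j q else 0) ≤
        (potential G s q - if q ∈ pend then gain G s j q else 0) +
          ((if q = p then weight G a else 0) - (if q = r then weight G a +
            (if r ∈ pend then topGain G s r * (1 - (P : ℝ)⁻¹) ^ j else 0) else 0)) := by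
      intro q
      by_cases hq : q = p
      · subst hq
        rw [if_neg hkp, hgp, hpp, if_pos rfl, if_neg h4.symm]
        simp [potential, steal, Function.update_of_ne h4.symm, h2]
      rw [if_neg hq]
      by_cases hqr : q = r
      · subst hqr
        have hk : q ∉ keep s (s.steal p q a) p pend := by
          rw [mem_keep, h3]
          rintro ⟨-, h5, -⟩
          simp only [steal, Function.update_self, h3, List.dropLast_concat] at h5
          have h6 : a ∈ l := List.mem_of_getLast? (by rw [h5]; simp)
          have h7 := (List.nodup_append.1 (hs.nodup q)).2.1
          rw [pending, h3, ← List.append_assoc, List.nodup_append'] at h7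
          exact h7.2.2 (List.mem_append_right _ h6) (by simp)
        have hpot : potential G (s.steal p q a) q = potential G s q - 3 * weight G a := by
          simp [potential, steal, Function.update_of_ne hq, h3]
          ring
        have hg : gain G s j q = 3 / 2 * weight G a * (1 - (1 - (P : ℝ)⁻¹) ^ j) := by
          rw [gain, hgr]
          simp [soleGain, h3]
        rw [if_neg hk, hpot, hg, hgr, if_pos rfl]
        split
        · nlinarith
        · linarith
      · rw [if_neg hqr, hother q hq (by simp [steal, Function.update_of_ne hq])
          (by simp [steal, Function.update_of_ne hqr])]
        simp
    refine (Finset.sum_le_sum fun q _ => key q).trans (le_of_eq ?_)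
    have hsum : ∑ q, ((if q = p then weight G a else 0) - (if q = r then weight G a +
        (if r ∈ pend then topGain G s r * (1 - (P : ℝ)⁻¹) ^ j else 0) else 0)) =
        -(if r ∈ pend then topGain G s r * (1 - (P : ℝ)⁻¹) ^ j else 0) := by
      rw [Finset.sum_sub_distrib, Finset.sum_ite_eq', Finset.sum_ite_eq']
      simp only [Finset.mem_univ, if_true]
      ring
    rw [Finset.sum_add_distrib, hsum]
    rfl

/-- An attempt to steal with a random victim does not increase the residual potential on average,
as it is taken into account by the decrease of the number of further attempts. -/
theorem sum_restPotential_steal_le [Finite V] (h : G.IsStructuredSingleTouch) {s : WSState V P}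
    (hs : s.Inv G) {p : Fin P} (hp : s.WantsToSteal p) (pend : Finset (Fin P)) (j : ℕ) :
    ∑ r, restPotential G (s.step G p r) (keep s (s.step G p r) p pend) (j - 1) ≤
      P * restPotential G s pend j := by
  classical
  obtain ⟨ha0, ha1⟩ := inv_P_le_one p
  have hP : (P : ℝ) ≠ 0 := by exact_mod_cast p.pos.ne'
  refine (Finset.sum_le_sum fun r _ => restPotential_steal_le h hs hp pend (j - 1) r).trans ?_
  rw [Finset.sum_sub_distrib, Finset.sum_const, Finset.card_univ, Fintype.card_fin, nsmul_eq_mul]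
  cases j with
  | zero =>
    have : 0 ≤ ∑ r, if r ∈ pend then topGain G s r * (1 - (P : ℝ)⁻¹) ^ (0 - 1) else 0 := by
      refine Finset.sum_nonneg fun r _ => ?_
      have := topGain_nonneg (G := G) s r
      split <;> simp [this]
    simp only [Nat.zero_sub] at this ⊢
    linarith
  | succ j =>
    rw [Nat.add_sub_cancel]
    refine le_of_eq ?_
    unfold restPotential
    rw [Finset.mul_sum, Finset.mul_sum, ← Finset.sum_sub_distrib]
    refine Finset.sum_congr rfl fun q _ => ?_
    split
    · unfold gain
      rw [pow_succ]
      field_simp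
      ring
    · ring

/-- At the start of a round a constant part of the potential is to be expected to vanish. -/
theorem restPotential_univ_le [Finite V] (h : G.IsStructuredSingleTouch) {s : WSState V P}
    (hs : s.Inv G) {M : ℕ} (hM : (1 - (P : ℝ)⁻¹) ^ M ≤ 1 / 2) :
    restPotential G s Finset.univ M ≤ 5 / 6 * ∑ q, potential G s q := by
  unfold restPotential
  rw [Finset.mul_sum]
  refine Finset.sum_le_sum fun q _ => ?_
  have := hs.potential_le_gain h hM q
  rw [if_pos (Finset.mem_univ q)]
  linarith

theorem one_le_sum_potential {s : WSState V P} {q : Fin P} (hq : s.pending q ≠ []) :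
    1 ≤ ∑ q, potential G s q := by
  refine le_trans ?_ (Finset.single_le_sum (fun q _ => potential_nonneg s q) (Finset.mem_univ q))
  have h1 := listWeight_nonneg (G := G) (s.current q).toList
  have h2 := listWeight_nonneg (G := G) (s.deque q)
  unfold potential
  cases hc : s.current q with
  | some v =>
    have := one_le_weight (G := G) v
    simp
    linarith
  | none =>
    cases hd : s.deque q with
    | nil => simp [pending, hc, hd] at hq
    | cons a d =>
      have := one_le_weight (G := G) a
      have := listWeight_nonneg (G := G) d
      simp
      linarith

end WSState

/-! ### Rounds -/

namespace WorkStealing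

open WSState

variable {V : Type u} {P : ℕ} {G : FutureGraph V} {p₀ : Fin P} {A : Scheduler P} {x : ℕ → Fin P}

/-- The bookkeeping for the division of an execution into rounds with the same number of attempts to
steal: `pend` contains the processors from which no decrease of the potential has been realized in
the current round, `left` is the number of further attempts to steal in this round, `count` is the
number of earlier rounds, and `start` is the time at which the current round started. -/
structure Round (P : ℕ) where
  pend : Finset (Fin P)
  left : ℕ
  count : ℕ
  start : ℕ

open Classical in
/-- The bookkeeping after an action of `p` that leads from `s` to `s'`, without the start of a new
round. -/
noncomputable def Round.next (ρ : Round P) (s s' : WSState V P) (p : Fin P) : Round P where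
  pend := s.keep s' p ρ.pend
  left := if s.WantsToSteal p then ρ.left - 1 else ρ.left
  count := ρ.count
  start := ρ.start

open Classical in
/-- The round at time `n`. A round consists of `M` attempts to steal, and a new one is started only
if there are nodes left to execute. -/
noncomputable def rounds (M : ℕ) (G : FutureGraph V) (p₀ : Fin P) (A : Scheduler P)
    (x : ℕ → Fin P) : ℕ → Round P
  | 0 => ⟨Finset.univ, M, 0, 0⟩
  | n + 1 =>
    let ρ := (rounds M G p₀ A x n).next (run G p₀ A x n) (run G p₀ A x (n + 1)) (actor A x n)
    if ρ.left = 0 ∧ ∃ q, (run G p₀ A x (n + 1)).pending q ≠ [] then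
      ⟨Finset.univ, M, ρ.count + 1, n + 1⟩
    else ρ

variable {M : ℕ}

open Classical in
/-- The number of attempts to steal at the times in `[i, n)`. -/
noncomputable def attempts (G : FutureGraph V) (p₀ : Fin P) (A : Scheduler P) (x : ℕ → Fin P)
    (i n : ℕ) : ℕ :=
  ((Finset.Ico i n).filter fun m => (run G p₀ A x m).WantsToSteal (actor A x m)).card

theorem start_le (n : ℕ) : (rounds M G p₀ A x n).start ≤ n := by
  induction n with
  | zero => simp [rounds]
  | succ n ih =>
    simp only [rounds]
    split
    · exact le_rfl
    · exact ih.trans (Nat.le_succ n)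

open Classical in
theorem attempts_succ {i n : ℕ} (hi : i ≤ n) : attempts G p₀ A x i (n + 1) =
    attempts G p₀ A x i n + if (run G p₀ A x n).WantsToSteal (actor A x n) then 1 else 0 := by
  unfold attempts
  rw [← Finset.insert_Ico_right_eq_Ico_add_one hi, Finset.filter_insert]
  split
  · rw [Finset.card_insert_of_notMem (by simp)]
  · rfl

/-- The round at time `n + 1`, before a new round is started. -/
noncomputable abbrev preRound (M : ℕ) (G : FutureGraph V) (p₀ : Fin P) (A : Scheduler P)
    (x : ℕ → Fin P) (n : ℕ) : Round P :=
  (rounds M G p₀ A x n).next (run G p₀ A x n) (run G p₀ A x (n + 1)) (actor A x n)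

theorem le_left_add_attempts_preRound {n : ℕ} (hn : M ≤ (rounds M G p₀ A x n).left +
    attempts G p₀ A x (rounds M G p₀ A x n).start n) :
    M ≤ (preRound M G p₀ A x n).left +
      attempts G p₀ A x (preRound M G p₀ A x n).start (n + 1) := by
  simp only [preRound, Round.next]
  rw [attempts_succ (start_le n)]
  split <;> omega

theorem le_left_add_attempts (n : ℕ) : M ≤ (rounds M G p₀ A x n).left +
    attempts G p₀ A x (rounds M G p₀ A x n).start n := by
  induction n with
  | zero => simp [rounds]
  | succ n ih =>
    have h1 := le_left_add_attempts_preRound ih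
    rw [rounds]
    split
    · simp
    · exact h1

theorem actor_ne_preRound {n : ℕ} (hn : ∀ q ∈ (rounds M G p₀ A x n).pend,
    (run G p₀ A x n).deque q = [] → ∀ m, (rounds M G p₀ A x n).start ≤ m → m < n →
      actor A x m ≠ q) :
    ∀ q ∈ (preRound M G p₀ A x n).pend, (run G p₀ A x (n + 1)).deque q = [] →
      ∀ m, (preRound M G p₀ A x n).start ≤ m → m < n + 1 → actor A x m ≠ q := by
  intro q hq hd m hm1 hm2
  simp only [preRound, Round.next] at hq hm1
  rw [mem_keep, hd] at hq
  obtain ⟨h1, h2, h3⟩ := hq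
  have hd' : (run G p₀ A x n).deque q = [] := List.getLast?_eq_none_iff.1 (by rw [← h2]; simp)
  rcases Nat.lt_succ_iff_lt_or_eq.1 hm2 with hm | rfl
  · exact hn q h1 hd' m hm1 hm
  · exact (h3 hd').symm

/-- A processor whose deque is empty has not acted in the current round as long as it is pending. -/
theorem actor_ne_of_mem_pend (n : ℕ) : ∀ q ∈ (rounds M G p₀ A x n).pend,
    (run G p₀ A x n).deque q = [] → ∀ m, (rounds M G p₀ A x n).start ≤ m → m < n →
      actor A x m ≠ q := by
  induction n with
  | zero =>
    intro q _ _ m _ hm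
    omega
  | succ n ih =>
    have h1 := actor_ne_preRound ih
    rw [rounds]
    split
    · intro q _ _ m hm1 hm2
      simp only at hm1
      omega
    · exact h1

/-- When a round is complete, every processor has acted in it by fairness. -/
theorem deque_ne_nil_of_left_eq_zero {κ : ℕ} (hA : IsFair κ G p₀ A)
    (hM : P * κ < M) {n : ℕ} (h0 : (preRound M G p₀ A x n).left = 0) {q : Fin P}
    (hq : q ∈ (preRound M G p₀ A x n).pend) : (run G p₀ A x (n + 1)).deque q ≠ [] := by
  classical
  intro hd
  have h1 := le_left_add_attempts_preRound (le_left_add_attempts (M := M) (G := G) (p₀ := p₀)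
    (A := A) (x := x) n)
  rw [h0, zero_add] at h1
  have h2 := actor_ne_preRound (actor_ne_of_mem_pend n) q hq hd
  set i := (preRound M G p₀ A x n).start
  obtain ⟨p, -, hp⟩ := Finset.exists_lt_card_fiber_of_mul_lt_card_of_maps_to (t := Finset.univ)
    (f := actor A x) (n := κ)
    (s := (Finset.Ico i (n + 1)).filter fun m => (run G p₀ A x m).WantsToSteal (actor A x m))
    (fun _ _ => Finset.mem_univ _) (by
      rw [Finset.card_univ, Fintype.card_fin]
      refine (hM.trans_le h1).trans_le (le_of_eq ?_)
      unfold attempts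
      congr)
  obtain ⟨m, hm1, hm2, hm3⟩ := hA x p i (n + 1) (by
    refine hp.trans_le (le_of_eq ?_)
    rw [← Set.ncard_coe_finset]
    congr 1
    ext m
    simp only [Finset.coe_filter, Finset.mem_filter, Finset.mem_Ico, StealAttempt,
      Set.mem_ofPred_eq]
    constructor
    · rintro ⟨⟨⟨h1, h2⟩, h3⟩, rfl⟩
      exact ⟨h1, h2, rfl, h3⟩
    · rintro ⟨h1, h2, rfl, h3⟩
      exact ⟨⟨⟨h1, h2⟩, h3⟩, rfl⟩) q
  exact h2 m hm1 hm2 hm3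

theorem steals_succ (n : ℕ) [Decidable (stolenAt G p₀ A x n).Nonempty] :
    steals G p₀ A x (n + 1) =
      steals G p₀ A x n + if (stolenAt G p₀ A x n).Nonempty then 1 else 0 := by
  classical
  unfold steals
  rw [Finset.range_add_one, Finset.filter_insert]
  split
  · rw [Finset.card_insert_of_notMem (by simp)]
  · rfl

/-- Every successful steal is an attempt to steal in one of the rounds. -/
theorem steals_add_left_le (hM : 0 < M) (n : ℕ) :
    steals G p₀ A x n + (rounds M G p₀ A x n).left ≤ M * ((rounds M G p₀ A x n).count + 1) ∧
      ((rounds M G p₀ A x n).left = 0 → ∀ q, (run G p₀ A x n).pending q = []) := by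
  classical
  induction n with
  | zero => exact ⟨by simp [rounds, steals], fun h0 => absurd h0 hM.ne'⟩
  | succ n ih =>
    obtain ⟨ih1, ih2⟩ := ih
    have hle : steals G p₀ A x (n + 1) + (preRound M G p₀ A x n).left ≤
        M * ((preRound M G p₀ A x n).count + 1) := by
      rw [steals_succ]
      simp only [preRound, Round.next]
      split
      · rename_i hne
        obtain ⟨a, h1, h2, h3⟩ := hne
        have hw : (run G p₀ A x n).WantsToSteal (actor A x n) := ⟨h1, h2⟩
        have hleft : (rounds M G p₀ A x n).left ≠ 0 := by
          intro h0
          have := ih2 h0 (x n)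
          simp only [pending, List.append_eq_nil_iff] at this
          simp [this.2] at h3
        rw [if_pos hw]
        omega
      · split <;> omega
    rw [rounds]
    split
    · rename_i hr
      have hr1 : (preRound M G p₀ A x n).left = 0 := hr.1
      refine ⟨?_, fun h0 => absurd h0 hM.ne'⟩
      change steals G p₀ A x (n + 1) + M ≤ M * ((preRound M G p₀ A x n).count + 1 + 1)
      rw [mul_add_one]
      omega
    · rename_i hr
      refine ⟨hle, fun h0 => ?_⟩
      by_contra hq
      push Not at hq
      exact hr ⟨h0, hq⟩

/-- The quantity that does not increase on average. Its first factor grows by a constant factor with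
every round, at the end of which the residual potential has decreased by a constant factor. -/
noncomputable def charge (M : ℕ) (G : FutureGraph V) (p₀ : Fin P) (A : Scheduler P)
    (x : ℕ → Fin P) (n : ℕ) : ℝ :=
  (12 / 11) ^ (rounds M G p₀ A x n).count *
    (restPotential G (run G p₀ A x n) (rounds M G p₀ A x n).pend (rounds M G p₀ A x n).left + 1)

/-- The start of a new round does not increase the charge. -/
theorem charge_succ_le [Finite V] (h : G.IsStructuredSingleTouch) {κ : ℕ}
    (hA : IsFair κ G p₀ A) (hM : P * κ < M) (hM' : (1 - (P : ℝ)⁻¹) ^ M ≤ 1 / 2) (n : ℕ) :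
    charge M G p₀ A x (n + 1) ≤ (12 / 11) ^ (rounds M G p₀ A x n).count *
      (restPotential G (run G p₀ A x (n + 1)) (preRound M G p₀ A x n).pend
        (preRound M G p₀ A x n).left + 1) := by
  unfold charge
  rw [rounds]
  split
  swap
  · exact le_rfl
  rename_i hr
  have hr1 : (preRound M G p₀ A x n).left = 0 := hr.1
  obtain ⟨q, hq⟩ := hr.2
  rw [hr1]
  change (12 / 11) ^ ((rounds M G p₀ A x n).count + 1) *
    (restPotential G (run G p₀ A x (n + 1)) Finset.univ M + 1) ≤ _
  rw [pow_succ, mul_assoc]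
  refine mul_le_mul_of_nonneg_left ?_ (by positivity)
  -- `5 / 6 * Φ + 1 ≤ 11 / 12 * (Φ + 1)`, since the potential `Φ` is at least `1`
  have h1 := restPotential_univ_le h (inv_run (p₀ := p₀) (A := A) (x := x) h (n + 1)) hM'
  have h2 := one_le_sum_potential (G := G) hq
  have h3 : restPotential G (run G p₀ A x (n + 1)) (preRound M G p₀ A x n).pend 0 =
      ∑ q, potential G (run G p₀ A x (n + 1)) q := by
    unfold restPotential
    refine Finset.sum_congr rfl fun q _ => ?_
    split
    · rename_i hq
      simp [gain, soleGain, deque_ne_nil_of_left_eq_zero hA hM hr1 hq]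
    · simp
  rw [h3]
  linarith

theorem actor_congr {y : ℕ → Fin P} {n : ℕ} (hxy : ∀ i < n, x i = y i) :
    actor A x n = actor A y n := by
  unfold actor
  congr 1
  funext i
  exact hxy i i.2

theorem run_congr {y : ℕ → Fin P} {n : ℕ} (hxy : ∀ i < n, x i = y i) :
    run G p₀ A x n = run G p₀ A y n := by
  induction n with
  | zero => rfl
  | succ n ih =>
    have h1 : ∀ i < n, x i = y i := fun i hi => hxy i (by omega)
    rw [run, run, ih h1, actor_congr h1, hxy n (by omega)]

theorem rounds_congr {y : ℕ → Fin P} {n : ℕ} (hxy : ∀ i < n, x i = y i) :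
    rounds M G p₀ A x n = rounds M G p₀ A y n := by
  induction n with
  | zero => rfl
  | succ n ih =>
    have h1 : ∀ i < n, x i = y i := fun i hi => hxy i (by omega)
    simp only [rounds, ih h1, run_congr hxy, run_congr h1, actor_congr h1]

theorem steals_congr {y : ℕ → Fin P} {n : ℕ} (hxy : ∀ i < n, x i = y i) :
    steals G p₀ A x n = steals G p₀ A y n := by
  classical
  induction n with
  | zero => simp [steals]
  | succ n ih =>
    have h1 : ∀ i < n, x i = y i := fun i hi => hxy i (by omega)
    have h2 : stolenAt G p₀ A x n = stolenAt G p₀ A y n := by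
      unfold stolenAt
      rw [run_congr h1, actor_congr h1, hxy n (by omega)]
    rw [steals_succ, steals_succ, ih h1, h2]

theorem steals_mono : Monotone (steals G p₀ A x) := by
  classical
  refine monotone_nat_of_le_succ fun n => ?_
  rw [steals_succ]
  exact Nat.le_add_right _ _

/-- The charge is a supermartingale. -/
theorem sum_charge_le [Finite V] (h : G.IsStructuredSingleTouch) {κ : ℕ}
    (hA : IsFair κ G p₀ A) (hM : P * κ < M) (hM' : (1 - (P : ℝ)⁻¹) ^ M ≤ 1 / 2) (x : ℕ → Fin P)
    (n : ℕ) :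
    ∑ r, charge M G p₀ A (Function.update x n r) (n + 1) ≤ P * charge M G p₀ A x n := by
  have hupd : ∀ r, ∀ i < n, Function.update x n r i = x i := fun r i hi =>
    Function.update_of_ne hi.ne _ _
  set s := run G p₀ A x n with hs
  set p := actor A x n with hp
  set ρ := rounds M G p₀ A x n with hρ
  have hrun : ∀ r, run G p₀ A (Function.update x n r) (n + 1) = s.step G p r := by
    intro r
    rw [run, run_congr (hupd r), actor_congr (hupd r), Function.update_self]
  have hpre : ∀ r, preRound M G p₀ A (Function.update x n r) n = ρ.next s (s.step G p r) p := by
    intro r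
    rw [preRound, hrun, run_congr (hupd r), actor_congr (hupd r), rounds_congr (hupd r)]
  have hinv : s.Inv G := inv_run h n
  have h1 : ∀ r, charge M G p₀ A (Function.update x n r) (n + 1) ≤ (12 / 11) ^ ρ.count *
      (restPotential G (s.step G p r) (keep s (s.step G p r) p ρ.pend)
        (ρ.next s (s.step G p r) p).left + 1) := by
    intro r
    have := charge_succ_le (x := Function.update x n r) h hA hM hM' n
    rwa [hrun, hpre, rounds_congr (hupd r)] at this
  refine (Finset.sum_le_sum fun r _ => h1 r).trans ?_
  rw [← Finset.mul_sum, Finset.sum_add_distrib, Finset.sum_const, Finset.card_univ,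
    Fintype.card_fin, nsmul_eq_mul, mul_one]
  have h2 : ∑ r, restPotential G (s.step G p r) (keep s (s.step G p r) p ρ.pend)
      (ρ.next s (s.step G p r) p).left ≤ P * restPotential G s ρ.pend ρ.left := by
    by_cases hw : s.WantsToSteal p
    · simp only [Round.next, if_pos hw]
      exact sum_restPotential_steal_le h hinv hw ρ.pend ρ.left
    · simp only [Round.next, if_neg hw]
      refine (Finset.sum_le_sum fun r _ => restPotential_step_le h hw ρ.pend ρ.left).trans ?_
      rw [Finset.sum_const, Finset.card_univ, Fintype.card_fin, nsmul_eq_mul]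
  calc (12 / 11 : ℝ) ^ ρ.count * (∑ r, restPotential G (s.step G p r)
        (keep s (s.step G p r) p ρ.pend) (ρ.next s (s.step G p r) p).left + P)
      ≤ (12 / 11 : ℝ) ^ ρ.count * (P * restPotential G s ρ.pend ρ.left + P) :=
        mul_le_mul_of_nonneg_left (by linarith) (by positivity)
    _ = P * charge M G p₀ A x n := by
        unfold charge
        ring

theorem charge_zero_le [Finite V] : charge M G p₀ A x 0 ≤ 9 ^ G.span + 1 := by
  have h1 : restPotential G (init G p₀) Finset.univ M ≤ ∑ q, potential G (init G p₀) q := by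
    refine Finset.sum_le_sum fun q _ => ?_
    have h1 : 0 ≤ gain G (init G p₀) M q := by
      obtain ⟨ha0, ha1⟩ := inv_P_le_one q
      refine add_nonneg (mul_nonneg (topGain_nonneg _ _) ?_) ?_
      · have := pow_le_one₀ (n := M) ha0 ha1
        linarith
      · unfold soleGain
        have := listWeight_nonneg (G := G) ((init G p₀).current q).toList
        split
        · linarith
        · exact le_rfl
    rw [if_pos (Finset.mem_univ q)]
    linarith
  have h2 : ∑ q, potential G (init G p₀) q = weight G G.root := by
    rw [Finset.sum_eq_single p₀]
    · simp [potential, init]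
    · intro q _ hq
      simp [potential, init, Function.update_of_ne hq]
    · simp
  have h3 : weight G G.root ≤ 9 ^ G.span := pow_le_pow_right₀ (by norm_num) (Nat.sub_le _ _)
  simp only [charge, rounds, run, pow_zero, one_mul]
  linarith

theorem pow_count_le_charge (n : ℕ) :
    (12 / 11) ^ (rounds M G p₀ A x n).count ≤ charge M G p₀ A x n := by
  have := restPotential_nonneg (G := G) (run G p₀ A x n) (rounds M G p₀ A x n).pend
    (rounds M G p₀ A x n).left
  exact le_mul_of_one_le_right (by positivity) (by linarith)

end WorkStealing

/-! ### Expectations -/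

namespace WorkStealing

variable {V : Type u} {P : ℕ} {G : FutureGraph V} {p₀ : Fin P} {A : Scheduler P}

/-- The sequence of random draws that begins with `a`, and goes on with `p₀`. -/
def extend (p₀ : Fin P) {n : ℕ} (a : Fin n → Fin P) : ℕ → Fin P := fun i =>
  if hi : i < n then a ⟨i, hi⟩ else p₀

theorem extend_snoc {n : ℕ} (a : Fin n → Fin P) (r : Fin P) :
    extend p₀ (Fin.snoc a r : Fin (n + 1) → Fin P) = Function.update (extend p₀ a) n r := by
  funext i
  rcases lt_trichotomy i n with hi | rfl | hi
  · rw [Function.update_of_ne hi.ne]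
    simp [extend, Fin.snoc, hi, Nat.lt_succ_of_lt hi]
  · simp [extend, Fin.snoc]
  · rw [Function.update_of_ne hi.ne']
    simp [extend, show ¬ i < n + 1 by omega, show ¬ i < n by omega]

theorem sum_extend_succ (n : ℕ) (f : (ℕ → Fin P) → ℝ) :
    ∑ a : Fin (n + 1) → Fin P, f (extend p₀ a) =
      ∑ a : Fin n → Fin P, ∑ r, f (Function.update (extend p₀ a) n r) := by
  rw [← Equiv.sum_comp (Fin.snocEquiv fun _ : Fin (n + 1) => Fin P), Fintype.sum_prod_type_right]
  refine Finset.sum_congr rfl fun a _ => Finset.sum_congr rfl fun r _ => ?_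
  rw [← extend_snoc]
  rfl

/-- The tangent of an exponential function lies below it. -/
theorem tangent_le (k n : ℕ) :
    (12 / 11 : ℝ) ^ k * (1 + ((n : ℝ) - k) / 11) ≤ (12 / 11) ^ n := by
  rcases le_total k n with hkn | hkn
  · obtain ⟨m, rfl⟩ := Nat.exists_eq_add_of_le hkn
    rw [pow_add]
    refine mul_le_mul_of_nonneg_left ?_ (by positivity)
    have := one_add_mul_le_pow (a := (1 / 11 : ℝ)) (by norm_num) m
    norm_num at this ⊢
    linarith
  · obtain ⟨m, rfl⟩ := Nat.exists_eq_add_of_le hkn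
    rw [pow_add, mul_assoc]
    refine mul_le_of_le_one_right (by positivity) ?_
    have h1 := one_add_mul_le_pow (a := (-1 / 12 : ℝ)) (by norm_num) m
    have h2 : (12 / 11 : ℝ) ^ m * (1 + -1 / 12) ^ m = 1 := by
      rw [← mul_pow]
      norm_num
    have h3 : (0 : ℝ) ≤ m := by positivity
    have h4 : 1 + ((n : ℝ) - ((n + m : ℕ) : ℝ)) / 11 ≤ (1 + -1 / 12) ^ m := by
      push_cast
      linarith
    calc (12 / 11 : ℝ) ^ m * (1 + ((n : ℝ) - ((n + m : ℕ) : ℝ)) / 11)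
        ≤ (12 / 11 : ℝ) ^ m * (1 + -1 / 12) ^ m :=
          mul_le_mul_of_nonneg_left h4 (by positivity)
      _ = 1 := h2

theorem nine_pow_add_one_le (T : ℕ) : (9 : ℝ) ^ T + 1 ≤ (12 / 11) ^ (32 * (T + 1)) := by
  have h1 : (16 : ℝ) ≤ (12 / 11) ^ 32 := by norm_num
  have h2 : (1 : ℝ) ≤ 9 ^ T := one_le_pow₀ (by norm_num)
  calc (9 : ℝ) ^ T + 1 ≤ 9 ^ T * 16 := by linarith
    _ ≤ 16 ^ T * 16 := by gcongr; norm_num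
    _ = 16 ^ (T + 1) := (pow_succ _ _).symm
    _ ≤ ((12 / 11) ^ 32) ^ (T + 1) := by gcongr
    _ = (12 / 11) ^ (32 * (T + 1)) := (pow_mul _ _ _).symm

theorem pow_le_half (p : Fin P) (κ : ℕ) : (1 - (P : ℝ)⁻¹) ^ (P * (κ + 1)) ≤ 1 / 2 := by
  obtain ⟨ha0, ha1⟩ := WSState.inv_P_le_one p
  have hP : (P : ℝ) ≠ 0 := by exact_mod_cast p.pos.ne'
  have h1 : (1 - (P : ℝ)⁻¹) ^ P ≤ 1 / 2 := by
    have h2 := Real.one_sub_le_exp_neg (P : ℝ)⁻¹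
    have h3 : (2 : ℝ) ≤ Real.exp 1 := by
      have := Real.add_one_le_exp (1 : ℝ)
      linarith
    calc (1 - (P : ℝ)⁻¹) ^ P ≤ Real.exp (-(P : ℝ)⁻¹) ^ P := pow_le_pow_left₀ ha0 h2 _
      _ = (Real.exp 1)⁻¹ := by
        rw [← Real.exp_nat_mul, mul_neg, mul_inv_cancel₀ hP, Real.exp_neg]
      _ ≤ 1 / 2 := by
        rw [one_div]
        exact inv_anti₀ (by norm_num) h3
  exact (pow_le_pow_of_le_one ha0 ha1 (Nat.le_mul_of_pos_right P (Nat.succ_pos κ))).trans h1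

/-- The average number of successful steals, for all sequences of `N` draws. Jensen's inequality for
the exponential function, in the form of its tangent, turns the bound for the charge into a bound
for the number of rounds. -/
theorem sum_steals_le [Finite V] (h : G.IsStructuredSingleTouch) {κ : ℕ} (hA : IsFair κ G p₀ A)
    (N : ℕ) : ∑ a : Fin N → Fin P, steals G p₀ A (extend p₀ a) N ≤
      P ^ N * (P * (κ + 1) * (32 * (G.span + 1) + 1)) := by
  have hP : 0 < P := p₀.pos
  set M := P * (κ + 1) with hMdef
  have hM : P * κ < M := by
    rw [hMdef, mul_add_one]
    omega
  have hM' : (1 - (P : ℝ)⁻¹) ^ M ≤ 1 / 2 := pow_le_half p₀ κ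
  have hcharge : ∀ n, ∑ a : Fin n → Fin P, charge M G p₀ A (extend p₀ a) n ≤
      (P : ℝ) ^ n * (9 ^ G.span + 1) := by
    intro n
    induction n with
    | zero =>
      rw [Fintype.sum_unique, pow_zero, one_mul]
      exact charge_zero_le
    | succ n ih =>
      rw [sum_extend_succ n fun x => charge M G p₀ A x (n + 1)]
      refine (Finset.sum_le_sum fun a _ => sum_charge_le h hA hM hM' (extend p₀ a) n).trans ?_
      rw [← Finset.mul_sum, pow_succ', mul_assoc]
      exact mul_le_mul_of_nonneg_left ih (by positivity)
  set k := 32 * (G.span + 1) with hk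
  have hcard : (∑ _a : Fin N → Fin P, (1 : ℝ)) = (P : ℝ) ^ N := by
    simp
  have hcount : (∑ a : Fin N → Fin P, ((rounds M G p₀ A (extend p₀ a) N).count : ℝ)) ≤
      (P : ℝ) ^ N * k := by
    have h1 : ∑ a : Fin N → Fin P, (12 / 11 : ℝ) ^ k *
        (1 + (((rounds M G p₀ A (extend p₀ a) N).count : ℝ) - k) / 11) ≤
        (P : ℝ) ^ N * (12 / 11) ^ k :=
      (Finset.sum_le_sum fun a _ => (tangent_le k _).trans (pow_count_le_charge N)).trans
        ((hcharge N).trans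
          (mul_le_mul_of_nonneg_left (nine_pow_add_one_le G.span) (by positivity)))
    rw [← Finset.mul_sum, mul_comm] at h1
    have h2 := le_of_mul_le_mul_right h1 (by positivity)
    rw [Finset.sum_add_distrib, hcard, ← Finset.sum_div, Finset.sum_sub_distrib, Finset.sum_const,
      Finset.card_univ, Fintype.card_fun, Fintype.card_fin, Fintype.card_fin, nsmul_eq_mul] at h2
    push_cast at h2
    linarith
  have hcount' : ∑ a : Fin N → Fin P, (rounds M G p₀ A (extend p₀ a) N).count ≤ P ^ N * k := by
    exact_mod_cast hcount
  have hMpos : 0 < M := by omega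
  calc ∑ a : Fin N → Fin P, steals G p₀ A (extend p₀ a) N
      ≤ ∑ a : Fin N → Fin P, M * ((rounds M G p₀ A (extend p₀ a) N).count + 1) :=
        Finset.sum_le_sum fun a _ =>
          (Nat.le_add_right _ _).trans (steals_add_left_le hMpos N).1
    _ = M * (∑ a : Fin N → Fin P, (rounds M G p₀ A (extend p₀ a) N).count + P ^ N) := by
        rw [← Finset.mul_sum, Finset.sum_add_distrib]
        simp
    _ ≤ M * (P ^ N * k + P ^ N) := Nat.mul_le_mul_left _ (by omega)
    _ = P ^ N * (M * (k + 1)) := by ring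

section Probability

variable {Ω : Type w} [MeasurableSpace Ω] {μ : Measure Ω} {X : ℕ → Ω → Fin P}

/-- The first draws are uniformly distributed. -/
theorem measure_draws (hX : iIndepFun X μ) (hu : ∀ n r, μ {ω | X n ω = r} = (P : ℝ≥0∞)⁻¹) {N : ℕ}
    (a : Fin N → Fin P) : μ {ω | (fun i : Fin N => X i ω) = a} = ((P : ℝ≥0∞)⁻¹) ^ N := by
  have h1 := (hX.precomp (g := fun i : Fin N => (i : ℕ)) Fin.val_injective)
  have h2 := h1.measure_inter_preimage_eq_mul Finset.univ (sets := fun i => {a i})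
    (fun i _ => measurableSet_singleton _)
  have h3 : {ω | (fun i : Fin N => X i ω) = a} =
      ⋂ i ∈ (Finset.univ : Finset (Fin N)), (fun ω => X i ω) ⁻¹' {a i} := by
    ext ω
    simp [funext_iff]
  rw [h3]
  refine h2.trans ((Finset.prod_congr rfl fun (i : Fin N) _ => hu i (a i)).trans ?_)
  rw [Finset.prod_const, Finset.card_univ, Fintype.card_fin]

theorem measurable_steals (hm : ∀ n, Measurable (X n)) (N : ℕ) :
    Measurable fun ω => (steals G p₀ A (fun n => X n ω) N : ℝ≥0∞) := by
  have h1 : Measurable fun ω => fun i : Fin N => X i ω := measurable_pi_lambda _ fun i => hm i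
  have h2 : (fun ω => (steals G p₀ A (fun n => X n ω) N : ℝ≥0∞)) =
      (fun a : Fin N → Fin P => (steals G p₀ A (extend p₀ a) N : ℝ≥0∞)) ∘
        fun ω => fun i : Fin N => X i ω := by
    funext ω
    simp only [Function.comp_apply]
    rw [steals_congr]
    intro i hi
    simp [extend, hi]
  rw [h2]
  exact (measurable_of_finite _).comp h1

theorem lintegral_steals_le [Finite V] (h : G.IsStructuredSingleTouch) {κ : ℕ}
    (hA : IsFair κ G p₀ A) (hm : ∀ n, Measurable (X n)) (hX : iIndepFun X μ)
    (hu : ∀ n r, μ {ω | X n ω = r} = (P : ℝ≥0∞)⁻¹) (N : ℕ) :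
    ∫⁻ ω, (steals G p₀ A (fun n => X n ω) N : ℝ≥0∞) ∂μ ≤
      ((P * (κ + 1) * (32 * (G.span + 1) + 1) : ℕ) : ℝ≥0∞) := by
  have h1 : Measurable fun ω => fun i : Fin N => X i ω := measurable_pi_lambda _ fun i => hm i
  set f : (Fin N → Fin P) → ℝ≥0∞ := fun a => (steals G p₀ A (extend p₀ a) N : ℝ≥0∞) with hf
  have h2 : ∀ ω, (steals G p₀ A (fun n => X n ω) N : ℝ≥0∞) = f fun i : Fin N => X i ω := by
    intro ω
    rw [hf]
    simp only
    rw [steals_congr]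
    intro i hi
    simp [extend, hi]
  have hP0 : (P : ℝ≥0∞) ≠ 0 := by exact_mod_cast p₀.pos.ne'
  calc ∫⁻ ω, (steals G p₀ A (fun n => X n ω) N : ℝ≥0∞) ∂μ
      = ∫⁻ ω, f (fun i : Fin N => X i ω) ∂μ := lintegral_congr h2
    _ = ∫⁻ a, f a ∂(μ.map fun ω => fun i : Fin N => X i ω) :=
        (lintegral_map (measurable_of_finite f) h1).symm
    _ = ∑ a, f a * ((P : ℝ≥0∞)⁻¹) ^ N := by
        rw [lintegral_fintype]
        refine Finset.sum_congr rfl fun a _ => ?_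
        rw [Measure.map_apply h1 (measurableSet_singleton a)]
        congr 1
        exact measure_draws hX hu a
    _ = ((∑ a : Fin N → Fin P, steals G p₀ A (extend p₀ a) N : ℕ) : ℝ≥0∞) *
          ((P : ℝ≥0∞)⁻¹) ^ N := by
        rw [← Finset.sum_mul, Nat.cast_sum]
    _ ≤ ((P ^ N * (P * (κ + 1) * (32 * (G.span + 1) + 1)) : ℕ) : ℝ≥0∞) *
          ((P : ℝ≥0∞)⁻¹) ^ N := by
        gcongr
        exact sum_steals_le h hA N
    _ = ((P * (κ + 1) * (32 * (G.span + 1) + 1) : ℕ) : ℝ≥0∞) := by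
        rw [Nat.cast_mul, Nat.cast_pow, mul_right_comm, ← mul_pow,
          ENNReal.mul_inv_cancel hP0 (ENNReal.natCast_ne_top P), one_pow, one_mul]

/-- The expected number of successful steals in the whole execution. -/
theorem lintegral_iSup_steals_le [Finite V] (h : G.IsStructuredSingleTouch) {κ : ℕ}
    (hA : IsFair κ G p₀ A) (hm : ∀ n, Measurable (X n)) (hX : iIndepFun X μ)
    (hu : ∀ n r, μ {ω | X n ω = r} = (P : ℝ≥0∞)⁻¹) :
    ∫⁻ ω, ⨆ N, (steals G p₀ A (fun n => X n ω) N : ℝ≥0∞) ∂μ ≤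
      ((P * (κ + 1) * (32 * (G.span + 1) + 1) : ℕ) : ℝ≥0∞) := by
  rw [lintegral_iSup (measurable_steals hm)]
  · exact iSup_le (lintegral_steals_le h hA hm hX hu)
  · intro m n hmn ω
    exact Nat.cast_le.2 (steals_mono hmn)

end Probability

theorem constant_le (κ P T : ℕ) :
    2 * T * (P * (κ + 1) * (32 * (T + 1) + 1)) ≤ 130 * (κ + 1) * P * T ^ 2 := by
  rcases Nat.eq_zero_or_pos T with rfl | hT
  · simp
  calc 2 * T * (P * (κ + 1) * (32 * (T + 1) + 1))
      ≤ 2 * T * (P * (κ + 1) * (65 * T)) := by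
        gcongr
        omega
    _ = 130 * (κ + 1) * P * T ^ 2 := by ring

end WorkStealing

theorem mainTheorem1 (κ : ℕ) :
    ∃ K : ℕ, ∀ (V : Type u) [Finite V] (G : FutureGraph V), G.IsStructuredSingleTouch →
      ∀ (P : ℕ) (p₀ : Fin P) (A : Scheduler P), WorkStealing.IsFair κ G p₀ A →
      ∀ (Ω : Type w) [MeasurableSpace Ω] (μ : Measure Ω) [IsProbabilityMeasure μ]
        (X : ℕ → Ω → Fin P),
        (∀ n, Measurable (X n)) → iIndepFun X μ →
        (∀ n r, μ {ω | X n ω = r} = (P : ℝ≥0∞)⁻¹) →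
        ∫⁻ ω, (WorkStealing.deviations G p₀ A (fun n => X n ω) : ℝ≥0∞) ∂μ
            ≤ K * P * (G.span : ℝ≥0∞) ^ 2 ∧
        ∀ (B : Type v) (C : ℕ) (acc : V → List B),
          ∫⁻ ω, WorkStealing.misses C acc G p₀ A (fun n => X n ω) ∂μ
            ≤ WorkStealing.seqMisses C acc G + K * C * P * (G.span : ℝ≥0∞) ^ 2 := by
  refine ⟨130 * (κ + 1), ?_⟩
  intro V _ G h P p₀ A hA Ω _ μ _ X hm hX hu
  set S : Ω → ℝ≥0∞ := fun ω => ⨆ N, (WorkStealing.steals G p₀ A (fun n => X n ω) N : ℝ≥0∞)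
    with hS
  have hint := WorkStealing.lintegral_iSup_steals_le h hA hm hX hu
  have hconst : ((2 * G.span : ℕ) : ℝ≥0∞) * ∫⁻ ω, S ω ∂μ ≤
      ((130 * (κ + 1) : ℕ) : ℝ≥0∞) * P * (G.span : ℝ≥0∞) ^ 2 := by
    refine (mul_le_mul_right hint _).trans ?_
    exact_mod_cast WorkStealing.constant_le κ P G.span
  constructor
  · refine le_trans ?_ hconst
    rw [← lintegral_const_mul' _ _ (ENNReal.natCast_ne_top _)]
    refine lintegral_mono fun ω => ?_
    obtain ⟨n, hn⟩ := WorkStealing.exists_deviations_le (p₀ := p₀) (A := A)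
      (x := fun n => X n ω) h
    calc (WorkStealing.deviations G p₀ A (fun n => X n ω) : ℝ≥0∞)
        ≤ ((2 * (WorkStealing.steals G p₀ A (fun n => X n ω) n * G.span) : ℕ) : ℝ≥0∞) := by
          exact_mod_cast hn
      _ = ((2 * G.span : ℕ) : ℝ≥0∞) * WorkStealing.steals G p₀ A (fun n => X n ω) n := by
          push_cast
          ring
      _ ≤ ((2 * G.span : ℕ) : ℝ≥0∞) * S ω :=
          mul_le_mul_right (le_iSup (fun N =>
            (WorkStealing.steals G p₀ A (fun n => X n ω) N : ℝ≥0∞)) n) _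
  · intro B C acc
    have hpt : ∀ ω, WorkStealing.misses C acc G p₀ A (fun n => X n ω) ≤
        WorkStealing.seqMisses C acc G + ((C * (2 * G.span) : ℕ) : ℝ≥0∞) * S ω := by
      intro ω
      refine iSup_le fun n => (WorkStealing.sum_lruMisses_le h C acc n).trans ?_
      refine add_le_add_right ?_ _
      calc ((C * (WorkStealing.exceptional G p₀ A (fun n => X n ω) n).ncard : ℕ) : ℝ≥0∞)
          ≤ ((C * (2 * (WorkStealing.steals G p₀ A (fun n => X n ω) n * G.span)) : ℕ) : ℝ≥0∞) := by
            exact_mod_cast Nat.mul_le_mul_left C (WorkStealing.ncard_exceptional_le h n)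
        _ = ((C * (2 * G.span) : ℕ) : ℝ≥0∞) *
              WorkStealing.steals G p₀ A (fun n => X n ω) n := by
            push_cast
            ring
        _ ≤ ((C * (2 * G.span) : ℕ) : ℝ≥0∞) * S ω :=
            mul_le_mul_right (le_iSup (fun N =>
              (WorkStealing.steals G p₀ A (fun n => X n ω) N : ℝ≥0∞)) n) _
    refine (lintegral_mono hpt).trans ?_
    rw [lintegral_add_left measurable_const, lintegral_const, measure_univ, mul_one,
      lintegral_const_mul' _ _ (ENNReal.natCast_ne_top _), Nat.cast_mul, mul_assoc]
    refine add_le_add_right ?_ _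
    calc (C : ℝ≥0∞) * (((2 * G.span : ℕ) : ℝ≥0∞) * ∫⁻ ω, S ω ∂μ)
        ≤ C * (((130 * (κ + 1) : ℕ) : ℝ≥0∞) * P * (G.span : ℝ≥0∞) ^ 2) :=
          mul_le_mul_right hconst _
      _ = _ := by ring
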